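/- **Setting.** Units are $8\pi G=c=1$, the signature is $(-,+,+,+)$, and all statements are local, made in coordinate patches. An LRS-II spacetime with cosmological constant $\Lambda$ is a Lorentzian metric $g_{ab}$ (with Levi-Civita connection $\nabla$ and $R_{ab}=R^c{}_{acb}$) solving $R_{ab}-\tfrac12Rg_{ab}+\Lambda g_{ab}=T_{ab}$, with vector fields $u^a,e^a$ such that $u^au_a=-1$, $e^ae_a=1$, $u^ae_a=0$. It is required that * around every point $q$ and for every angle $\theta$ there is a local isometry fixing $q$, preserving $u$ and $e$, and acting on the sheet (the plane orthogonal to $u,e$) at $q$ as the rotation by $\theta$; * there is no rotation: with $h_{ab}=g_{ab}+u_au_b$, $N_{ab}=h_{ab}-e_ae_b$ and $D_av_b=h_a{}^ch_b{}^d\nabla_cv_d$, one has $D_{[a}u_{b]}=0$ and $N_a{}^cN_b{}^dD_{[c}e_{d]}=0$. Put $\dot\psi=u^a\nabla_a\psi$, $\hat\psi=e^a\nabla_a\psi$ for scalars, and $$\mathcal A=e^bu^a\nabla_au_b,\quad \Theta=h^{ab}D_au_b,\quad \Sigma=e^ae^b\big(D_{(a}u_{b)}-\tfrac13\Theta h_{ab}\big),\quad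 \phi=N^{ab}D_ae_b,\quad \mathcal E=C_{acbd}e^au^ce^bu^d,$$ $$\mu=T_{ab}u^au^b,\quad p=\tfrac13h^{ab}T_{ab},\quad Q=-e^ah_a{}^cT_{cd}u^d,\quad \Pi=e^ae^b\big(h_a{}^ch_b{}^dT_{cd}-p\,h_{ab}\big),$$ where $C_{abcd}$ is the Weyl tensor. Let two LRS-II spacetimes with the same $\Lambda$ (quantities of the second carry a tilde) contain embedded hypersurfaces with common intrinsic coordinates, i.e. two images of one matching surface $S$, whose points are thereby identified. Let $n^a=\alpha u^a+\beta e^a$ and $\tilde n^a=\tilde\alpha\tilde u^a+\tilde\beta\tilde e^a$ be $C^1$ vector fields with $n^an_a=\tilde n^a\tilde n_a=\varepsilon$ which are normal to $S$ along $S$; $\varepsilon=1$ if $S$ is timelike, $\varepsilon=-1$ if $S$ is spacelike. The matching constraint is $$F=\tilde F,\qquad F=\beta\phi-\alpha\left(\Sigma-\tfrac23\Theta\right),\qquad (23)$$ with $\tilde F$ defined likewise. Let $$\begin{aligned}\mathbb X={}&\alpha\dot\beta\phi+\alpha\beta\left[-\left(\Sigma-\tfrac23\Theta\right)\left(\mathcal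 A-\tfrac12\phi\right)+Q\right]+\beta\hat\beta\phi\\ &+\beta^2\left[-\tfrac12\phi^2+\left(\tfrac13\Theta+\Sigma\right)\left(\tfrac23\Theta-\Sigma\right)-\tfrac23(\mu+\Lambda)-\mathcal E-\tfrac12\Pi\right]\\ &-\alpha^2\left[-\mathcal A\phi+2\left(\tfrac13\Theta-\tfrac12\Sigma\right)^2+\tfrac13(\mu+3p-2\Lambda)-\mathcal E+\tfrac12\Pi\right]\\ &+\alpha\beta\left(\tfrac32\phi\Sigma+Q\right)-\hat\alpha\beta\left(\Sigma-\tfrac23\Theta\right)-\dot\alpha\alpha\left(\Sigma-\tfrac23\Theta\right),\end{aligned}$$ and let $\tilde{\mathbb X}$ be defined likewise. **Statement.** In both cases $\varepsilon=\pm1$: 1. At each point of the two spacetimes, $\beta=\pm\sqrt{1+\alpha^2}$ and $\tilde\beta=\pm\sqrt{1+\tilde\alpha^2}$ if $S$ is timelike; $\alpha^2,\tilde\alpha^2\ge1$, $\beta=\pm\sqrt{\alpha^2-1}$ and $\tilde\beta=\pm\sqrt{\tilde\alpha^2-1}$ if $S$ is spacelike. 2. $F$ and $\tilde F$ are differentiable,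 with $n^a\nabla_aF=\mathbb X$ and $\tilde n^a\nabla_a\tilde F=\tilde{\mathbb X}$ everywhere. Hence, at each point of $S$, the normal derivatives of the two sides of (23) agree, $n^a\nabla_aF=\tilde n^a\nabla_a\tilde F$, if and only if $$\mathbb X=\tilde{\mathbb X}.\qquad (C1)$$ 3. Let $\gamma,\tilde\gamma$ be integral curves of $n,\tilde n$, defined on a common open interval containing $0$ and starting at identified points of $S$. Then (23) holds along them for all parameter values $s$, i.e. $F(\gamma(s))=\tilde F(\tilde\gamma(s))$, if and only if it holds at $s=0$ and $\mathbb X(\gamma(s))=\tilde{\mathbb X}(\tilde\gamma(s))$ for all $s$. -/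

import Mathlib

noncomputable section

namespace LRS

/-- Points of a coordinate patch of a four-dimensional spacetime, and also component tuples
of tangent vectors at such points. -/
abbrev Coord := Fin 4 → ℝ

/-- The partial derivative of a scalar `f` in the coordinate `a`. -/
def pd (a : Fin 4) (f : Coord → ℝ) (x : Coord) : ℝ := fderiv ℝ f x (Pi.single a 1)

/-- The derivative `v^a ∂_a f` of a scalar `f` along a vector field `v`. -/
def dirDeriv (v : Coord → Coord) (f : Coord → ℝ) (x : Coord) : ℝ :=
  ∑ a, v x a * pd a f x

/-- A coordinate patch of a spacetime: an open set of `ℝ⁴` with a Lorentzian metric of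
signature `(-,+,+,+)`, given by its components. -/
structure Spacetime where
  domain : Set Coord
  isOpen_domain : IsOpen domain
  g : Coord → Matrix (Fin 4) (Fin 4) ℝ
  contDiffOn_g : ∀ a b, ContDiffOn ℝ 2 (fun x => g x a b) domain
  isSymm_g : ∀ x ∈ domain, (g x).IsSymm
  lorentzian : ∀ x ∈ domain, ∃ P : Matrix (Fin 4) (Fin 4) ℝ,
    IsUnit P.det ∧ P.transpose * g x * P = Matrix.diagonal ![-1, 1, 1, 1]

namespace Spacetime

variable (M : Spacetime)

/-- The inverse metric `g^{ab}`. -/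
def ginv (x : Coord) : Matrix (Fin 4) (Fin 4) ℝ := (M.g x)⁻¹

/-- The scalar product `g_{ab} v^a w^b` at `x`. -/
def ip (x v w : Coord) : ℝ := ∑ a, ∑ b, M.g x a b * v a * w b

/-- Lowering an index: `v_a = g_{ab} v^b`. -/
def lower (v : Coord → Coord) (a : Fin 4) (x : Coord) : ℝ := ∑ b, M.g x a b * v x b

/-- The Christoffel symbols `Γ^c_{ab}` of the Levi-Civita connection. -/
def christoffel (c a b : Fin 4) (x : Coord) : ℝ :=
  1 / 2 * ∑ d, M.ginv x c d *
    (pd a (fun y => M.g y b d) x + pd b (fun y => M.g y d a) x - pd d (fun y => M.g y a b) x)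

/-- The components `∇_a v_b` of the covariant derivative of (the covector of) `v`. -/
def nabla (v : Coord → Coord) (a b : Fin 4) (x : Coord) : ℝ :=
  pd a (M.lower v b) x - ∑ c, M.christoffel c a b x * M.lower v c x

/-- The Riemann tensor `R^a_{bcd}`, with
`R^a_{bcd} = ∂_c Γ^a_{db} - ∂_d Γ^a_{cb} + Γ^a_{ce} Γ^e_{db} - Γ^a_{de} Γ^e_{cb}`. -/
def riemannUp (a b c d : Fin 4) (x : Coord) : ℝ :=
  pd c (M.christoffel a d b) x - pd d (M.christoffel a c b) x
    + ∑ k, (M.christoffel a c k x * M.christoffel k d b x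
      - M.christoffel a d k x * M.christoffel k c b x)

/-- The Riemann tensor `R_{abcd}` with all indices down. -/
def riemann (a b c d : Fin 4) (x : Coord) : ℝ := ∑ k, M.g x a k * M.riemannUp k b c d x

/-- The Ricci tensor `R_{ab} = R^c_{acb}`. -/
def ricci (a b : Fin 4) (x : Coord) : ℝ := ∑ c, M.riemannUp c a c b x

/-- The scalar curvature `g^{ab} R_{ab}`. -/
def scalarCurv (x : Coord) : ℝ := ∑ a, ∑ b, M.ginv x a b * M.ricci a b x

/-- The Weyl tensor `C_{abcd}` in dimension four. -/
def weyl (a b c d : Fin 4) (x : Coord) : ℝ :=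
  M.riemann a b c d x
    - 1 / 2 * (M.g x a c * M.ricci b d x - M.g x a d * M.ricci b c x
      - M.g x b c * M.ricci a d x + M.g x b d * M.ricci a c x)
    + M.scalarCurv x / 6 * (M.g x a c * M.g x b d - M.g x a d * M.g x b c)

/-- The mixed projector `h_a^b = δ_a^b + u_a u^b` onto the 3-space orthogonal to `u`. -/
def hMixed (u : Coord → Coord) (a b : Fin 4) (x : Coord) : ℝ :=
  (if a = b then 1 else 0) + M.lower u a x * u x b

/-- `h_{ab} = g_{ab} + u_a u_b`. -/
def hDown (u : Coord → Coord) (a b : Fin 4) (x : Coord) : ℝ :=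
  M.g x a b + M.lower u a x * M.lower u b x

/-- `h^{ab} = g^{ab} + u^a u^b`. -/
def hUp (u : Coord → Coord) (a b : Fin 4) (x : Coord) : ℝ :=
  M.ginv x a b + u x a * u x b

/-- The mixed projector `N_a^b = h_a^b - e_a e^b` onto the sheet orthogonal to `u` and `e`. -/
def sheetMixed (u e : Coord → Coord) (a b : Fin 4) (x : Coord) : ℝ :=
  M.hMixed u a b x - M.lower e a x * e x b

/-- `N^{ab} = h^{ab} - e^a e^b`. -/
def sheetUp (u e : Coord → Coord) (a b : Fin 4) (x : Coord) : ℝ :=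
  M.hUp u a b x - e x a * e x b

/-- The derivative `D_a v_b = h_a^c h_b^d ∇_c v_d`, projected orthogonally to `u`. -/
def projNabla (u v : Coord → Coord) (a b : Fin 4) (x : Coord) : ℝ :=
  ∑ c, ∑ d, M.hMixed u a c x * M.hMixed u b d x * M.nabla v c d x

/-- `s, t` is an orthonormal basis of the sheet at `p`, the plane orthogonal to `u` and `e`. -/
def IsSheetBasis (u e : Coord → Coord) (p s t : Coord) : Prop :=
  M.ip p s s = 1 ∧ M.ip p t t = 1 ∧ M.ip p s t = 0 ∧
  M.ip p s (u p) = 0 ∧ M.ip p s (e p) = 0 ∧ M.ip p t (u p) = 0 ∧ M.ip p t (e p) = 0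

/-- `f` is, on the neighbourhood `V` of its fixed point `p`, an isometry of the spacetime into
itself which maps the vector fields `u` and `e` to themselves. -/
def IsLocalSymmetry (u e : Coord → Coord) (p : Coord) (V : Set Coord) (f : Coord → Coord) :
    Prop :=
  IsOpen V ∧ p ∈ V ∧ V ⊆ M.domain ∧ Set.MapsTo f V M.domain ∧ ContDiffOn ℝ 2 f V ∧ f p = p ∧
  (∀ x ∈ V, ∀ v w : Coord, M.ip (f x) (fderiv ℝ f x v) (fderiv ℝ f x w) = M.ip x v w) ∧
  (∀ x ∈ V, fderiv ℝ f x (u x) = u (f x)) ∧ (∀ x ∈ V, fderiv ℝ f x (e x) = e (f x))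

/-- Local rotational symmetry about `e`: at every point the isotropy group contains the
rotations of the sheet through all angles `θ`. -/
def IsLocallyRotationallySymmetric (u e : Coord → Coord) : Prop :=
  ∀ p ∈ M.domain, ∃ s t : Coord, M.IsSheetBasis u e p s t ∧
    ∀ θ : ℝ, ∃ (V : Set Coord) (f : Coord → Coord), M.IsLocalSymmetry u e p V f ∧
      fderiv ℝ f p s = Real.cos θ • s + Real.sin θ • t ∧
      fderiv ℝ f p t = -Real.sin θ • s + Real.cos θ • t

/-- The congruence `u` has no vorticity: `D_{[a} u_{b]} = 0`. -/
def IsVorticityFree (u : Coord → Coord) : Prop :=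
  ∀ x ∈ M.domain, ∀ a b, M.projNabla u u a b x = M.projNabla u u b a x

/-- The congruence `e` does not twist the sheets: `N_a^c N_b^d D_{[c} e_{d]} = 0`. -/
def IsTwistFree (u e : Coord → Coord) : Prop :=
  ∀ x ∈ M.domain, ∀ a b,
    ∑ c, ∑ d, M.sheetMixed u e a c x * M.sheetMixed u e b d x *
      (M.projNabla u e c d x - M.projNabla u e d c x) = 0

end Spacetime

/-- (A coordinate patch of) an LRS-II spacetime with energy-momentum tensor `T` and cosmological
constant `Λ`, in units with `8πG = c = 1`: a solution of the Einstein field equations that is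
locally rotationally symmetric and free of rotation, with its unit timelike vector field `u` and
its preferred unit spacelike vector field `e`. -/
structure LRSII (Λ : ℝ) extends Spacetime where
  T : Coord → Matrix (Fin 4) (Fin 4) ℝ
  einstein : ∀ x ∈ domain, ∀ a b,
    toSpacetime.ricci a b x - 1 / 2 * toSpacetime.scalarCurv x * g x a b + Λ * g x a b = T x a b
  u : Coord → Coord
  e : Coord → Coord
  contDiffOn_u : ContDiffOn ℝ 2 u domain
  contDiffOn_e : ContDiffOn ℝ 2 e domain
  ip_u_u : ∀ x ∈ domain, toSpacetime.ip x (u x) (u x) = -1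
  ip_e_e : ∀ x ∈ domain, toSpacetime.ip x (e x) (e x) = 1
  ip_u_e : ∀ x ∈ domain, toSpacetime.ip x (u x) (e x) = 0
  symmetric : toSpacetime.IsLocallyRotationallySymmetric u e
  vorticityFree : toSpacetime.IsVorticityFree u
  twistFree : toSpacetime.IsTwistFree u e

namespace LRSII

variable {Λ : ℝ} (L : LRSII Λ)

/-- The derivative of a scalar along the flow lines, `u^a ∇_a ψ`. -/
def dot (ψ : Coord → ℝ) : Coord → ℝ := dirDeriv L.u ψ

/-- The derivative of a scalar along the preferred direction, `e^a D_a ψ = e^a ∇_a ψ`. -/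
def hat (ψ : Coord → ℝ) : Coord → ℝ := dirDeriv L.e ψ

/-- `𝒜 = e^b (u^a ∇_a u_b)`, the acceleration. -/
def accel (x : Coord) : ℝ := ∑ a, ∑ b, L.u x a * L.e x b * L.nabla L.u a b x

/-- `Θ = D_a u^a`, the expansion. -/
def Theta (x : Coord) : ℝ := ∑ a, ∑ b, L.hUp L.u a b x * L.projNabla L.u L.u a b x

/-- `σ_{ab} = D_{⟨a} u_{b⟩}`, the shear tensor. -/
def shear (a b : Fin 4) (x : Coord) : ℝ :=
  1 / 2 * (L.projNabla L.u L.u a b x + L.projNabla L.u L.u b a x)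
    - 1 / 3 * L.Theta x * L.hDown L.u a b x

/-- `Σ = σ_{ab} e^a e^b`. -/
def Sigma (x : Coord) : ℝ := ∑ a, ∑ b, L.e x a * L.e x b * L.shear a b x

/-- `φ = N^{ab} D_a e_b`, the expansion of the sheet. -/
def phi (x : Coord) : ℝ := ∑ a, ∑ b, L.sheetUp L.u L.e a b x * L.projNabla L.u L.e a b x

/-- `E_{ab} = C_{acbd} u^c u^d`, the electric part of the Weyl tensor. -/
def electricWeyl (a b : Fin 4) (x : Coord) : ℝ :=
  ∑ c, ∑ d, L.weyl a c b d x * L.u x c * L.u x d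

/-- `ℰ = E_{ab} e^a e^b`. -/
def electric (x : Coord) : ℝ := ∑ a, ∑ b, L.e x a * L.e x b * L.electricWeyl a b x

/-- `μ = T_{ab} u^a u^b`, the energy density. -/
def mu (x : Coord) : ℝ := ∑ a, ∑ b, L.T x a b * L.u x a * L.u x b

/-- `p = (1/3) h^{ab} T_{ab}`, the isotropic pressure. -/
def pressure (x : Coord) : ℝ := 1 / 3 * ∑ a, ∑ b, L.hUp L.u a b x * L.T x a b

/-- `q_a = - h_a^c T_{cd} u^d`, the heat flux. -/
def heatFlux (a : Fin 4) (x : Coord) : ℝ :=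
  -∑ c, ∑ d, L.hMixed L.u a c x * L.T x c d * L.u x d

/-- `Q = q_a e^a`. -/
def Q (x : Coord) : ℝ := ∑ a, L.heatFlux a x * L.e x a

/-- `π_{ab} = T_{⟨ab⟩}`, the anisotropic stress; `T` is symmetric by the field equations. -/
def anisoStress (a b : Fin 4) (x : Coord) : ℝ :=
  ∑ c, ∑ d, L.hMixed L.u a c x * L.hMixed L.u b d x * L.T x c d
    - L.pressure x * L.hDown L.u a b x

/-- `Π = π_{ab} e^a e^b`. -/
def Pi (x : Coord) : ℝ := ∑ a, ∑ b, L.e x a * L.e x b * L.anisoStress a b x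

/-- The `u`-component `α` of a vector field `n = α u + β e`. -/
def alpha (n : Coord → Coord) (x : Coord) : ℝ := -L.ip x (n x) (L.u x)

/-- The `e`-component `β` of a vector field `n = α u + β e`. -/
def beta (n : Coord → Coord) (x : Coord) : ℝ := L.ip x (n x) (L.e x)

/-- One side `β φ - α (Σ - (2/3) Θ)` of the matching constraint. -/
def constraintScalar (n : Coord → Coord) (x : Coord) : ℝ :=
  L.beta n x * L.phi x - L.alpha n x * (L.Sigma x - 2 / 3 * L.Theta x)

/-- The scalar `𝕏`. -/
def bbX (n : Coord → Coord) (x : Coord) : ℝ :=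
  L.alpha n x * L.dot (L.beta n) x * L.phi x
  + L.alpha n x * L.beta n x *
      (-(L.Sigma x - 2 / 3 * L.Theta x) * (L.accel x - 1 / 2 * L.phi x) + L.Q x)
  + L.beta n x * L.hat (L.beta n) x * L.phi x
  + L.beta n x ^ 2 *
      (-(1 / 2) * L.phi x ^ 2
        + (1 / 3 * L.Theta x + L.Sigma x) * (2 / 3 * L.Theta x - L.Sigma x)
        - 2 / 3 * (L.mu x + Λ) - L.electric x - 1 / 2 * L.Pi x)
  - L.alpha n x ^ 2 *
      (-L.accel x * L.phi x + 2 * (1 / 3 * L.Theta x - 1 / 2 * L.Sigma x) ^ 2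
        + 1 / 3 * (L.mu x + 3 * L.pressure x - 2 * Λ) - L.electric x + 1 / 2 * L.Pi x)
  + L.alpha n x * L.beta n x * (3 / 2 * L.phi x * L.Sigma x + L.Q x)
  - L.hat (L.alpha n) x * L.beta n x * (L.Sigma x - 2 / 3 * L.Theta x)
  - L.dot (L.alpha n) x * L.alpha n x * (L.Sigma x - 2 / 3 * L.Theta x)

/-- `X`, restricted to the open set `Ξ` of intrinsic coordinates, is an embedded hypersurface of
the spacetime inheriting its symmetry, and `n` is a field extending the unit normal: `n` has no
sheet component, `n^a n_a = ε`, and `n` is orthogonal to the hypersurface. The hypersurface is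
timelike if `ε = 1` and spacelike if `ε = -1`. -/
structure IsMatchingSurface (ε : ℝ) (Ξ : Set (Fin 3 → ℝ)) (X : (Fin 3 → ℝ) → Coord)
    (n : Coord → Coord) : Prop where
  isOpen : IsOpen Ξ
  mapsTo : Set.MapsTo X Ξ L.domain
  contDiffOn : ContDiffOn ℝ 3 X Ξ
  immersion : ∀ ξ ∈ Ξ, Function.Injective (fderiv ℝ X ξ)
  embedding : Topology.IsEmbedding (Ξ.domRestrict X)
  contDiffOn_normal : ContDiffOn ℝ 1 n L.domain
  no_sheet_component : ∀ x ∈ L.domain, n x = L.alpha n x • L.u x + L.beta n x • L.e x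
  norm_normal : ∀ x ∈ L.domain, L.ip x (n x) (n x) = ε
  normal : ∀ ξ ∈ Ξ, ∀ v : Fin 3 → ℝ, L.ip (X ξ) (n (X ξ)) (fderiv ℝ X ξ v) = 0

/-- `γ` is, on `I`, an integral curve of the vector field `n` in the spacetime. -/
def IsNormalCurve (n : Coord → Coord) (γ : ℝ → Coord) (I : Set ℝ) : Prop :=
  ∀ s ∈ I, γ s ∈ L.domain ∧ HasDerivAt γ (n (γ s)) s

end LRSII

end LRS

end

/-!
Write `θ = (2/3) Θ - Σ = N^{ab} ∇_a u_b`, so that the constraint is `F = β φ + α θ`. Since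
`n = α u + β e`, the normal derivative of `F` is `α Ḟ + β F̂`, and the claim `n^a ∇_a F = 𝕏` says
that `φ̇`, `φ̂`, `θ̇`, `θ̂` are given by four of the evolution and propagation equations of LRS-II
spacetimes (`LRSII.evolution_propagation`). Everything else is elementary: `β² = ε + α²` is the
normalisation of `n`, and two functions on an interval agree if and only if they agree at one point
and have the same derivative.

The four equations are Ricci identities. At every point there is an adapted orthonormal basis
`u, e, s, t`. An isometry fixing the point preserves `∇u` and `∇e`
(`Spacetime.IsLocalSymmetry.nab_map`), since these are built from the metric, the vector field and
their first derivatives, and the second derivatives of the isometry drop out. Invariance under the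
rotation of the sheet by a right angle, together with the absence of vorticity and twist, forces
`∇_a u_b = K_a e_b + ½ θ N_{ab}` and `∇_a e_b = K_a u_b + ½ φ N_{ab}` (`LRSII.exists_frame`), with a
one-form `K` vanishing on the sheet. As this holds at every point, it may be differentiated. Inserted
into the Ricci identity for `u` or `e`, contracted with `w^a s^b s^c` where `w` is `u` or `e`, it
expresses the derivative of `θ` or `φ` along `w` by the Riemann component `R(u, s, w, s)` or
`R(e, s, w, s)` (`LRSII.fderiv_sheet_expansion`). Summing over `s` and `t` yields Ricci components and
`R(e, u, e, u)`; the field equations turn the former into `μ`, `p`, `Q`, `Π`, and the definition of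
the Weyl tensor turns the latter into `ℰ`. In this way no invariance of the curvature itself is
needed, which would require third derivatives of the isometries.

Tensors are contracted with vectors whose components are constant in the coordinate patch; the
Christoffel symbols then enter through the vector `Spacetime.chr`.
-/

noncomputable section

/-! ### Contractions, the Levi-Civita connection and the Koszul formula -/

namespace LRS

/-- The value `B_{ab} v^a w^b` of the bilinear form with components `B`. -/
def contr (B : Fin 4 → Fin 4 → ℝ) (v w : Coord) : ℝ := ∑ a, ∑ b, B a b * v a * w b

lemma contr_add_left (B : Fin 4 → Fin 4 → ℝ) (v v' w : Coord) :
    contr B (v + v') w = contr B v w + contr B v' w := by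
  simp [contr, mul_add, add_mul, Finset.sum_add_distrib]

lemma contr_add_right (B : Fin 4 → Fin 4 → ℝ) (v w w' : Coord) :
    contr B v (w + w') = contr B v w + contr B v w' := by
  simp [contr, mul_add, Finset.sum_add_distrib]

lemma contr_smul_left (B : Fin 4 → Fin 4 → ℝ) (c : ℝ) (v w : Coord) :
    contr B (c • v) w = c * contr B v w := by
  simp only [contr, Finset.mul_sum, Pi.smul_apply, smul_eq_mul]
  exact Finset.sum_congr rfl fun a _ => Finset.sum_congr rfl fun b _ => by ring

lemma contr_smul_right (B : Fin 4 → Fin 4 → ℝ) (c : ℝ) (v w : Coord) :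
    contr B v (c • w) = c * contr B v w := by
  simp only [contr, Finset.mul_sum, Pi.smul_apply, smul_eq_mul]
  exact Finset.sum_congr rfl fun a _ => Finset.sum_congr rfl fun b _ => by ring

lemma contr_neg_left (B : Fin 4 → Fin 4 → ℝ) (v w : Coord) :
    contr B (-v) w = -contr B v w := by
  simpa using contr_smul_left B (-1) v w

lemma contr_neg_right (B : Fin 4 → Fin 4 → ℝ) (v w : Coord) :
    contr B v (-w) = -contr B v w := by
  simpa using contr_smul_right B (-1) v w

lemma contr_symm {B : Fin 4 → Fin 4 → ℝ} (h : ∀ a b, B a b = B b a) (v w : Coord) :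
    contr B v w = contr B w v := by
  rw [contr, contr, Finset.sum_comm]
  exact Finset.sum_congr rfl fun a _ => Finset.sum_congr rfl fun b _ => by rw [h]; ring

lemma contr_prod (l k : Fin 4 → ℝ) (v w : Coord) :
    contr (fun a b => l a * k b) v w = (∑ a, l a * v a) * ∑ b, k b * w b := by
  rw [contr, Finset.sum_mul_sum]
  exact Finset.sum_congr rfl fun a _ => Finset.sum_congr rfl fun b _ => by ring

/-- The product rule for `B_{ab} v^a w^b`, all three factors varying. -/
lemma fderiv_contr {B : Coord → Fin 4 → Fin 4 → ℝ} {B' : Fin 4 → Fin 4 → Coord →L[ℝ] ℝ}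
    {V W : Coord → Coord} {V' W' : Coord →L[ℝ] Coord} {p : Coord}
    (hB : ∀ a b, HasFDerivAt (fun y => B y a b) (B' a b) p)
    (hV : HasFDerivAt V V' p) (hW : HasFDerivAt W W' p) :
    DifferentiableAt ℝ (fun y => contr (B y) (V y) (W y)) p ∧
    ∀ z, fderiv ℝ (fun y => contr (B y) (V y) (W y)) p z =
      contr (fun a b => B' a b z) (V p) (W p) + contr (B p) (V' z) (W p)
        + contr (B p) (V p) (W' z) := by
  have hV' := fun a => (hasFDerivAt_pi'.1 hV) a
  have hW' := fun a => (hasFDerivAt_pi'.1 hW) a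
  have key := HasFDerivAt.fun_sum (u := Finset.univ) fun a _ =>
    HasFDerivAt.fun_sum (u := Finset.univ) fun b _ => ((hB a b).mul (hV' a)).mul (hW' b)
  refine ⟨key.differentiableAt, fun z => ?_⟩
  refine (congrArg (fun L : Coord →L[ℝ] ℝ => L z) key.fderiv).trans ?_
  simp only [contr, sum_apply, ← Finset.sum_add_distrib]
  refine Finset.sum_congr rfl fun a _ => Finset.sum_congr rfl fun b _ => ?_
  simp
  ring

lemma sum_pd (f : Coord → ℝ) (x v : Coord) : ∑ a, v a * pd a f x = fderiv ℝ f x v := by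
  conv_rhs => rw [pi_eq_sum_univ' v]
  simp [pd]

lemma dirDeriv_eq (v : Coord → Coord) (f : Coord → ℝ) (x : Coord) :
    dirDeriv v f x = fderiv ℝ f x (v x) := sum_pd f x (v x)

lemma pd_symm {f : Coord → ℝ} {x : Coord} (hf : ContDiffAt ℝ 2 f x) (a b : Fin 4) :
    pd a (pd b f) x = pd b (pd a f) x := by
  have hs : IsSymmSndFDerivAt ℝ f x := hf.isSymmSndFDerivAt (by simp)
  have hd : DifferentiableAt ℝ (fderiv ℝ f) x :=
    (hf.fderiv_right (m := 1) (by norm_num)).differentiableAt (by norm_num)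
  have h (a b : Fin 4) : pd a (pd b f) x
      = fderiv ℝ (fderiv ℝ f) x (Pi.single a 1) (Pi.single b 1) := by
    change fderiv ℝ (fun y => fderiv ℝ f y (Pi.single b 1)) x (Pi.single a 1) = _
    rw [fderiv_clm_apply hd (differentiableAt_const _)]
    simp
  rw [h, h, hs.eq]

lemma differentiableAt_pd {f : Coord → ℝ} {x : Coord} (hf : ContDiffAt ℝ 2 f x) (a : Fin 4) :
    DifferentiableAt ℝ (pd a f) x :=
  ((hf.fderiv_right (m := 1) (by norm_num)).differentiableAt (by norm_num)).clm_apply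
    (differentiableAt_const _)

namespace Spacetime

variable (M : Spacetime)

/-- The covariant derivative `∇_a v_b` at `x`, contracted with the vectors `a` and `b`. -/
def nab (v : Coord → Coord) (x a b : Coord) : ℝ := contr (fun i j => M.nabla v i j x) a b

/-- The vector `Γ^c_{ab} v^a w^b`. -/
def chr (x v w : Coord) : Coord := fun c => contr (fun a b => M.christoffel c a b x) v w

/-- The derivative of `g_{ab} v^a w^b` in the direction `z`, for constant `v` and `w`. -/
def dg (x z v w : Coord) : ℝ := contr (fun a b => fderiv ℝ (fun y => M.g y a b) x z) v w

lemma ip_eq_contr (x v w : Coord) : M.ip x v w = contr (M.g x) v w := rfl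

section linearity

variable (x v v' w : Coord) (c : ℝ)

lemma ip_add_left : M.ip x (v + v') w = M.ip x v w + M.ip x v' w := contr_add_left _ _ _ _
lemma ip_add_right : M.ip x w (v + v') = M.ip x w v + M.ip x w v' := contr_add_right _ _ _ _
lemma ip_smul_left : M.ip x (c • v) w = c * M.ip x v w := contr_smul_left _ _ _ _
lemma ip_smul_right : M.ip x w (c • v) = c * M.ip x w v := contr_smul_right _ _ _ _

lemma ip_zero_left : M.ip x 0 w = 0 := by simp [ip]

end linearity

variable {M} {p : Coord}

lemma g_symm (hp : p ∈ M.domain) (a b : Fin 4) : M.g p a b = M.g p b a :=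
  (M.isSymm_g p hp).apply b a

lemma ip_symm (hp : p ∈ M.domain) (v w : Coord) : M.ip p v w = M.ip p w v :=
  contr_symm (g_symm hp) v w

lemma isUnit_det_g (hp : p ∈ M.domain) : IsUnit (M.g p).det := by
  obtain ⟨P, hP, h⟩ := M.lorentzian p hp
  have := congrArg Matrix.det h
  rw [Matrix.det_mul, Matrix.det_mul, Matrix.det_diagonal] at this
  rw [isUnit_iff_ne_zero]
  intro h0
  simp [h0, Fin.prod_univ_four] at this

lemma lower_eq (v : Coord → Coord) (x : Coord) (a : Fin 4) :
    M.lower v a x = contr (M.g x) (Pi.single a 1) (v x) := by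
  simp [contr, lower, Pi.single_apply]

lemma sum_lower (v : Coord → Coord) (x b : Coord) :
    ∑ a, M.lower v a x * b a = M.ip x b (v x) := by
  simp only [lower, ip, Finset.sum_mul]
  exact Finset.sum_congr rfl fun a _ => Finset.sum_congr rfl fun c _ => by ring

lemma contDiffAt_g (hp : p ∈ M.domain) (a b : Fin 4) :
    ContDiffAt ℝ 2 (fun y => M.g y a b) p :=
  (M.contDiffOn_g a b).contDiffAt (M.isOpen_domain.mem_nhds hp)

lemma differentiableAt_g (hp : p ∈ M.domain) (a b : Fin 4) :
    DifferentiableAt ℝ (fun y => M.g y a b) p :=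
  (contDiffAt_g hp a b).differentiableAt (by norm_num)

lemma fderiv_ip (hp : p ∈ M.domain) {V W : Coord → Coord}
    (hV : DifferentiableAt ℝ V p) (hW : DifferentiableAt ℝ W p) :
    DifferentiableAt ℝ (fun y => M.ip y (V y) (W y)) p ∧
    ∀ z, fderiv ℝ (fun y => M.ip y (V y) (W y)) p z =
      M.dg p z (V p) (W p) + M.ip p (fderiv ℝ V p z) (W p) + M.ip p (V p) (fderiv ℝ W p z) :=
  fderiv_contr (B := M.g) (fun a b => (differentiableAt_g hp a b).hasFDerivAt)
    hV.hasFDerivAt hW.hasFDerivAt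

lemma fderiv_ip_const (hp : p ∈ M.domain) (v w z : Coord) :
    fderiv ℝ (fun y => M.ip y v w) p z = M.dg p z v w := by
  rw [(fderiv_ip hp (differentiableAt_const v) (differentiableAt_const w)).2]
  simp [ip_eq_contr, contr]

lemma eventually_mem (hp : p ∈ M.domain) : ∀ᶠ y in nhds p, y ∈ M.domain :=
  M.isOpen_domain.mem_nhds hp

lemma fderiv_g_symm (hp : p ∈ M.domain) (a b : Fin 4) :
    fderiv ℝ (fun y => M.g y a b) p = fderiv ℝ (fun y => M.g y b a) p :=
  Filter.EventuallyEq.fderiv_eq ((eventually_mem hp).mono fun _ hy => g_symm hy a b)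

lemma dg_symm (hp : p ∈ M.domain) (z v w : Coord) : M.dg p z v w = M.dg p z w v :=
  contr_symm (fun a b => by rw [fderiv_g_symm hp]) v w

lemma christoffel_symm (hp : p ∈ M.domain) (c a b : Fin 4) :
    M.christoffel c a b p = M.christoffel c b a p := by
  unfold christoffel pd
  congr 1
  refine Finset.sum_congr rfl fun d _ => ?_
  rw [fderiv_g_symm hp b d, fderiv_g_symm hp d a, fderiv_g_symm hp a b]
  ring

lemma chr_symm (hp : p ∈ M.domain) (v w : Coord) : M.chr p v w = M.chr p w v :=
  funext fun c => contr_symm (christoffel_symm hp c) v w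

lemma dg_eq_sum (x z v w : Coord) :
    M.dg x z v w = ∑ i, ∑ a, ∑ b, pd i (fun y => M.g y a b) x * z i * v a * w b := by
  rw [← Finset.sum_comm_cycle, dg, contr]
  refine Finset.sum_congr rfl fun a _ => Finset.sum_congr rfl fun b _ => ?_
  rw [← sum_pd, Finset.sum_mul, Finset.sum_mul]
  exact Finset.sum_congr rfl fun i _ => by ring

/-- The Koszul formula for the Christoffel symbols, all indices down. -/
lemma sum_g_christoffel (hp : p ∈ M.domain) (a b d : Fin 4) :
    ∑ c, M.g p d c * M.christoffel c a b p = 1 / 2 *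
      (pd a (fun y => M.g y b d) p + pd b (fun y => M.g y d a) p
        - pd d (fun y => M.g y a b) p) := by
  set k : Fin 4 → ℝ := fun d => pd a (fun y => M.g y b d) p + pd b (fun y => M.g y d a) p
        - pd d (fun y => M.g y a b) p
  have h : (M.g p).mulVec ((M.ginv p).mulVec k) = k := by
    rw [Matrix.mulVec_mulVec, ginv, Matrix.mul_nonsing_inv _ (isUnit_det_g hp),
      Matrix.one_mulVec]
  have h' := congrFun h d
  simp only [Matrix.mulVec, dotProduct] at h'
  rw [show (pd a (fun y => M.g y b d) p + pd b (fun y => M.g y d a) p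
        - pd d (fun y => M.g y a b) p) = k d from rfl, ← h', Finset.mul_sum]
  refine Finset.sum_congr rfl fun c _ => ?_
  simp only [christoffel, k]
  ring

/-- The Koszul formula, contracted with three vectors. -/
lemma ip_chr (hp : p ∈ M.domain) (a c b : Coord) :
    M.ip p (M.chr p a c) b
      = 1 / 2 * (M.dg p a c b + M.dg p c a b - M.dg p b a c) := by
  have h1 : M.ip p (M.chr p a c) b = ∑ d, ∑ i, ∑ j,
      (∑ k, M.g p d k * M.christoffel k i j p) * a i * c j * b d := by
    rw [ip_symm hp]
    simp only [ip, chr, contr, Finset.mul_sum, Finset.sum_mul]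
    refine Finset.sum_congr rfl fun d _ => ?_
    rw [Finset.sum_comm]
    refine Finset.sum_congr rfl fun i _ => ?_
    rw [Finset.sum_comm]
    refine Finset.sum_congr rfl fun j _ => Finset.sum_congr rfl fun k _ => ?_
    ring
  have h2 : M.dg p a c b = ∑ i, ∑ j, ∑ d,
      pd i (fun y => M.g y j d) p * a i * c j * b d := dg_eq_sum _ _ _ _
  have h3 : M.dg p c a b = ∑ i, ∑ j, ∑ d,
      pd j (fun y => M.g y d i) p * a i * c j * b d := by
    rw [dg_eq_sum, Finset.sum_comm]
    exact Finset.sum_congr rfl fun i _ => Finset.sum_congr rfl fun j _ =>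
      Finset.sum_congr rfl fun d _ => by rw [pd, pd, fderiv_g_symm hp d i]; ring
  have h4 : M.dg p b a c = ∑ i, ∑ j, ∑ d,
      pd d (fun y => M.g y i j) p * a i * c j * b d := by
    rw [dg_eq_sum, ← Finset.sum_comm_cycle]
    exact Finset.sum_congr rfl fun i _ => Finset.sum_congr rfl fun j _ =>
      Finset.sum_congr rfl fun d _ => by ring
  rw [h1, h2, h3, h4, ← Finset.sum_comm_cycle]
  simp only [sum_g_christoffel hp, ← Finset.sum_add_distrib, ← Finset.sum_sub_distrib,
    Finset.mul_sum]
  exact Finset.sum_congr rfl fun i _ => Finset.sum_congr rfl fun j _ =>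
    Finset.sum_congr rfl fun d _ => by ring

/-- `∇g = 0`. -/
lemma dg_eq_chr (hp : p ∈ M.domain) (z v w : Coord) :
    M.dg p z v w = M.ip p (M.chr p z v) w + M.ip p v (M.chr p z w) := by
  rw [ip_symm hp v, ip_chr hp, ip_chr hp, dg_symm hp z w v]
  ring

/-- In `∇_a v_b = ∂_a v_b - Γ^c_{ab} v_c` the vectors contracting the indices may be pulled
inside the derivative if they are constant. -/
lemma nab_eq_fderiv {v : Coord → Coord} (hp : p ∈ M.domain) (hv : DifferentiableAt ℝ v p)
    (a b : Coord) :
    M.nab v p a b = fderiv ℝ (fun y => M.ip y b (v y)) p a - M.ip p (v p) (M.chr p a b) := by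
  have hl (j : Fin 4) : DifferentiableAt ℝ (M.lower v j) p := by
    have := (fderiv_ip hp (differentiableAt_const (Pi.single j 1)) hv).1
    simpa only [ip_eq_contr, ← lower_eq] using this
  have h1 : (fun y => M.ip y b (v y)) = fun y => ∑ j, M.lower v j y * b j :=
    funext fun y => (sum_lower v y b).symm
  rw [h1, fderiv_fun_sum fun j _ => (hl j).mul_const _, sum_apply, ip_symm hp,
    ← sum_lower]
  have h2 (j : Fin 4) : fderiv ℝ (fun y => M.lower v j y * b j) p a
      = ∑ i, pd i (M.lower v j) p * a i * b j := by
    rw [fderiv_mul_const (hl j), smul_apply, ← sum_pd, smul_eq_mul,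
      Finset.mul_sum]
    exact Finset.sum_congr rfl fun i _ => by ring
  simp only [h2, nab, contr, nabla, chr, sub_mul, Finset.sum_sub_distrib]
  congr 1
  · rw [Finset.sum_comm]
  · simp only [Finset.mul_sum, Finset.sum_mul]
    rw [Finset.sum_comm_cycle]
    exact Finset.sum_congr rfl fun i _ => Finset.sum_congr rfl fun j _ =>
      Finset.sum_congr rfl fun d _ => by ring

/-- `∇_a v_b = g_{bc} (∂_a v^c + Γ^c_{ad} v^d)`. -/
lemma nab_eq_ip {v : Coord → Coord} (hp : p ∈ M.domain) (hv : DifferentiableAt ℝ v p)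
    (a b : Coord) : M.nab v p a b = M.ip p (fderiv ℝ v p a + M.chr p a (v p)) b := by
  rw [nab_eq_fderiv hp hv, (fderiv_ip hp (differentiableAt_const b) hv).2,
    dg_symm hp, dg_eq_chr hp, ip_add_left, ip_symm hp b]
  simp only [fderiv_fun_const, Pi.zero_apply, zero_apply, ip_zero_left]
  ring

end Spacetime

end LRS

/-! ### Invariance of the connection under isometries; adapted orthonormal bases -/

namespace LRS

namespace Spacetime

variable {M : Spacetime} {p : Coord}

section isometry

variable {u e : Coord → Coord} {V : Set Coord} {f : Coord → Coord}

/-- The transformation law of the metric derivative under an isometry fixing `p`. -/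
lemma IsLocalSymmetry.dg_eq (h : M.IsLocalSymmetry u e p V f) (z v w : Coord) :
    M.dg p z v w = M.dg p (fderiv ℝ f p z) (fderiv ℝ f p v) (fderiv ℝ f p w)
      + M.ip p (fderiv ℝ (fderiv ℝ f) p z v) (fderiv ℝ f p w)
      + M.ip p (fderiv ℝ f p v) (fderiv ℝ (fderiv ℝ f) p z w) := by
  obtain ⟨hV, hpV, hVM, -, hf, hfp, hg, -, -⟩ := h
  have hp := hVM hpV
  have hf := hf.contDiffAt (hV.mem_nhds hpV)
  have hJ := (hf.differentiableAt (by norm_num)).hasFDerivAt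
  have hD : HasFDerivAt (fderiv ℝ f) (fderiv ℝ (fderiv ℝ f) p) p :=
    ((hf.fderiv_right (m := 1) (by norm_num)).differentiableAt (by norm_num)).hasFDerivAt
  have hDv (a : Coord) : HasFDerivAt (fun x => fderiv ℝ f x a)
      ((fderiv ℝ (fderiv ℝ f) p).flip a) p := by
    simpa using hD.clm_apply (hasFDerivAt_const a p)
  have hB (a b : Fin 4) : HasFDerivAt (fun x => M.g (f x) a b)
      ((fderiv ℝ (fun y => M.g y a b) p).comp (fderiv ℝ f p)) p := by
    have := (differentiableAt_g hp a b).hasFDerivAt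
    rw [← hfp] at this
    have := this.comp p hJ
    rwa [hfp] at this
  have key := (fderiv_contr (B := fun x => M.g (f x)) hB (hDv v) (hDv w)).2 z
  rw [← fderiv_ip_const hp, ← Filter.EventuallyEq.fderiv_eq
    (Filter.eventually_of_mem (hV.mem_nhds hpV) fun x hx => hg x hx v w)]
  simpa [hfp, ip_eq_contr, dg] using key

/-- `∇v` at `p` is invariant under an isometry fixing `p` and preserving the vector field `v`. -/
lemma IsLocalSymmetry.nab_map (h : M.IsLocalSymmetry u e p V f) {v : Coord → Coord}
    (hv : DifferentiableAt ℝ v p) (hfv : ∀ x ∈ V, fderiv ℝ f x (v x) = v (f x)) (a b : Coord) :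
    M.nab v p (fderiv ℝ f p a) (fderiv ℝ f p b) = M.nab v p a b := by
  have hdg := h.dg_eq
  obtain ⟨hV, hpV, hVM, -, hf, hfp, hg, -, -⟩ := h
  have hp := hVM hpV
  have hf := hf.contDiffAt (hV.mem_nhds hpV)
  have hJ := (hf.differentiableAt (by norm_num)).hasFDerivAt
  have hD : HasFDerivAt (fderiv ℝ f) (fderiv ℝ (fderiv ℝ f) p) p :=
    ((hf.fderiv_right (m := 1) (by norm_num)).differentiableAt (by norm_num)).hasFDerivAt
  have hs : IsSymmSndFDerivAt ℝ f p := hf.isSymmSndFDerivAt (by simp)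
  have hvp : fderiv ℝ f p (v p) = v p := by rw [hfv p hpV, hfp]
  -- differentiating `Df (v) = v ∘ f` at `p`
  have h1 : fderiv ℝ v p (fderiv ℝ f p a)
      = fderiv ℝ (fderiv ℝ f) p a (v p) + fderiv ℝ f p (fderiv ℝ v p a) := by
    have e1 := (hD.clm_apply hv.hasFDerivAt).fderiv
    have e2 : fderiv ℝ (fun x => v (f x)) p = (fderiv ℝ v p).comp (fderiv ℝ f p) := by
      have hv' := hv.hasFDerivAt
      rw [← hfp] at hv'
      have := (hv'.comp p hJ).fderiv
      rwa [hfp] at this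
    rw [Filter.EventuallyEq.fderiv_eq (Filter.eventually_of_mem (hV.mem_nhds hpV) hfv),
      e2] at e1
    have := congrArg (fun L : Coord →L[ℝ] Coord => L a) e1
    simpa [add_comm] using this
  have hJg := hg p hpV (fderiv ℝ v p a) b
  rw [hfp] at hJg
  rw [nab_eq_ip hp hv, nab_eq_ip hp hv, h1, ip_add_left, ip_add_left, ip_add_left,
    ip_chr hp, ip_chr hp, hdg a (v p) b, hdg (v p) a b, hdg b a (v p), hJg, hvp,
    hs.eq (v p) a, hs.eq b a, hs.eq b (v p),
    ip_symm hp (fderiv ℝ (fderiv ℝ f) p a b) (v p),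
    ip_symm hp (fderiv ℝ f p a) (fderiv ℝ (fderiv ℝ f) p (v p) b)]
  ring

end isometry

section frame

variable {u e : Coord → Coord} {s t : Coord}

/-- In an adapted orthonormal basis the inverse metric is `-u u + e e + s s + t t`. -/
lemma ginv_eq (hp : p ∈ M.domain) (huu : M.ip p (u p) (u p) = -1)
    (hee : M.ip p (e p) (e p) = 1) (hue : M.ip p (u p) (e p) = 0)
    (hst : M.IsSheetBasis u e p s t) (a b : Fin 4) :
    M.ginv p a b = -(u p a * u p b) + e p a * e p b + s a * s b + t a * t b := by
  obtain ⟨hss, htt, hst, hsu, hse, htu, hte⟩ := hst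
  let F : Fin 4 → Coord := ![u p, e p, s, t]
  let E : Matrix (Fin 4) (Fin 4) ℝ := Matrix.of F
  have hE (i j : Fin 4) : (E * M.g p * E.transpose) i j = M.ip p (F i) (F j) := by
    simp only [E, Matrix.of_apply, Matrix.mul_apply, Matrix.transpose_apply, ip, Finset.sum_mul]
    rw [Finset.sum_comm]
    exact Finset.sum_congr rfl fun a _ => Finset.sum_congr rfl fun b _ => by ring
  have h1 : E * M.g p * E.transpose = Matrix.diagonal ![-1, 1, 1, 1] := by
    ext i j
    rw [hE]
    fin_cases i <;> fin_cases j <;>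
      simp [F, huu, hee, hue, hss, htt, hst, hsu, hse, htu, hte, ip_symm hp (e p) (u p),
        ip_symm hp (u p) s, ip_symm hp (e p) s, ip_symm hp (u p) t, ip_symm hp (e p) t,
        ip_symm hp t s]
  have h2 : E * (M.g p * E.transpose * Matrix.diagonal ![-1, 1, 1, 1]) = 1 := by
    rw [← mul_assoc, ← mul_assoc, h1, Matrix.diagonal_mul_diagonal]
    ext i j
    fin_cases i <;> fin_cases j <;> simp
  have h3 : M.g p * (E.transpose * Matrix.diagonal ![-1, 1, 1, 1] * E) = 1 := by
    rw [← mul_eq_one_comm] at h2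
    simpa [mul_assoc] using h2
  rw [ginv, Matrix.inv_eq_right_inv h3]
  simp [Matrix.mul_apply, Fin.sum_univ_four, E, F, Matrix.diagonal_apply]

/-- The trace of a bilinear form in an adapted orthonormal basis. -/
lemma sum_ginv_mul (hp : p ∈ M.domain) (huu : M.ip p (u p) (u p) = -1)
    (hee : M.ip p (e p) (e p) = 1) (hue : M.ip p (u p) (e p) = 0)
    (hst : M.IsSheetBasis u e p s t) (B : Fin 4 → Fin 4 → ℝ) :
    ∑ a, ∑ b, M.ginv p a b * B a b =
      -contr B (u p) (u p) + contr B (e p) (e p) + contr B s s + contr B t t := by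
  simp only [ginv_eq hp huu hee hue hst, contr, ← Finset.sum_neg_distrib,
    ← Finset.sum_add_distrib]
  exact Finset.sum_congr rfl fun a _ => Finset.sum_congr rfl fun b _ => by ring

/-- The expansion of a vector in an adapted orthonormal basis. -/
lemma eq_frame (hp : p ∈ M.domain) (huu : M.ip p (u p) (u p) = -1)
    (hee : M.ip p (e p) (e p) = 1) (hue : M.ip p (u p) (e p) = 0)
    (hst : M.IsSheetBasis u e p s t) (v : Coord) :
    v = (-M.ip p v (u p)) • u p + M.ip p v (e p) • e p + M.ip p v s • s + M.ip p v t • t := by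
  have h : (M.ginv p).mulVec ((M.g p).mulVec v) = v := by
    rw [Matrix.mulVec_mulVec, ginv, Matrix.nonsing_inv_mul _ (isUnit_det_g hp),
      Matrix.one_mulVec]
  have hl (w : Coord) : M.ip p v w = ∑ b, w b * (M.g p).mulVec v b := by
    rw [ip_symm hp]
    simp only [ip, Matrix.mulVec, dotProduct, Finset.mul_sum]
    exact Finset.sum_congr rfl fun a _ => Finset.sum_congr rfl fun b _ => by ring
  conv_lhs => rw [← h]
  funext a
  simp only [Matrix.mulVec, dotProduct, ginv_eq hp huu hee hue hst, hl, Pi.add_apply,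
    Pi.smul_apply, smul_eq_mul, Finset.sum_mul, ← Finset.sum_add_distrib,
    ← Finset.sum_neg_distrib]
  exact Finset.sum_congr rfl fun b _ => by ring

/-- A bilinear form is determined by its components in an adapted orthonormal basis. Here it is
isotropic in the sheet, and `u`, `e` contracted with the first index leave no sheet component. -/
lemma contr_eq_of_isotropic (hp : p ∈ M.domain) (huu : M.ip p (u p) (u p) = -1)
    (hee : M.ip p (e p) (e p) = 1) (hue : M.ip p (u p) (e p) = 0)
    (hst : M.IsSheetBasis u e p s t) {B : Fin 4 → Fin 4 → ℝ} {c : ℝ}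
    (hus : contr B (u p) s = 0) (hut : contr B (u p) t = 0)
    (hes : contr B (e p) s = 0) (het : contr B (e p) t = 0)
    (h1 : contr B s t = 0) (h2 : contr B t s = 0)
    (hss : contr B s s = c) (htt : contr B t t = c) (v w : Coord) :
    contr B v w = -M.ip p w (u p) * contr B v (u p) + M.ip p w (e p) * contr B v (e p)
      + c * (M.ip p v w + M.ip p v (u p) * M.ip p w (u p) - M.ip p v (e p) * M.ip p w (e p)) := by
  have hvw : M.ip p v w = -M.ip p v (u p) * M.ip p w (u p) + M.ip p v (e p) * M.ip p w (e p)
      + M.ip p v s * M.ip p w s + M.ip p v t * M.ip p w t := by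
    conv_lhs => rw [eq_frame hp huu hee hue hst w]
    simp only [ip_add_right, ip_smul_right]
    ring
  have hs : contr B v s = c * M.ip p v s := by
    conv_lhs => rw [eq_frame hp huu hee hue hst v]
    simp only [contr_add_left, contr_smul_left, hus, hes, hss, h2]
    ring
  have ht : contr B v t = c * M.ip p v t := by
    conv_lhs => rw [eq_frame hp huu hee hue hst v]
    simp only [contr_add_left, contr_smul_left, hut, het, htt, h1]
    ring
  conv_lhs => rw [eq_frame hp huu hee hue hst w]
  simp only [contr_add_right, contr_smul_right, hs, ht]
  rw [hvw]
  ring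

end frame

/-- `v^b ∇_a w_b + w^b ∇_a v_b = ∂_a (v^b w_b)`. -/
lemma fderiv_ip_eq_nab (hp : p ∈ M.domain) {v w : Coord → Coord} (hv : DifferentiableAt ℝ v p)
    (hw : DifferentiableAt ℝ w p) (a : Coord) :
    fderiv ℝ (fun y => M.ip y (v y) (w y)) p a = M.nab v p a (w p) + M.nab w p a (v p) := by
  rw [(fderiv_ip hp hv hw).2, dg_eq_chr hp, nab_eq_ip hp hv, nab_eq_ip hp hw,
    ip_add_left, ip_add_left, ip_symm hp (v p), ip_symm hp (v p)]
  ring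

lemma nab_add_nab_eq_zero (hp : p ∈ M.domain) {v w : Coord → Coord}
    (hv : DifferentiableAt ℝ v p) (hw : DifferentiableAt ℝ w p) {c : ℝ}
    (h : ∀ x ∈ M.domain, M.ip x (v x) (w x) = c) (a : Coord) :
    M.nab v p a (w p) + M.nab w p a (v p) = 0 := by
  rw [← fderiv_ip_eq_nab hp hv hw,
    Filter.EventuallyEq.fderiv_eq ((eventually_mem hp).mono h)]
  simp

lemma sum_hMixed (u : Coord → Coord) (x a : Coord) (c : Fin 4) :
    ∑ i, M.hMixed u i c x * a i = (a + M.ip x a (u x) • u x) c := by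
  simp only [hMixed, add_mul, ite_mul, one_mul, zero_mul, Finset.sum_add_distrib,
    Finset.sum_ite_eq', Finset.mem_univ, if_true, Pi.add_apply, Pi.smul_apply, smul_eq_mul]
  rw [← sum_lower, Finset.sum_mul]
  simp [mul_comm, mul_left_comm]

lemma sum_comm_pairs (F : Fin 4 → Fin 4 → Fin 4 → Fin 4 → ℝ) :
    ∑ i, ∑ j, ∑ c, ∑ d, F i j c d = ∑ c, ∑ d, ∑ i, ∑ j, F i j c d := by
  have := Finset.sum_comm (s := (Finset.univ : Finset (Fin 4)) ×ˢ (Finset.univ : Finset (Fin 4)))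
    (t := (Finset.univ : Finset (Fin 4)) ×ˢ (Finset.univ : Finset (Fin 4)))
    (f := fun x y => F x.1 x.2 y.1 y.2)
  simpa only [Finset.sum_product] using this

lemma contr_mixed (P R B : Fin 4 → Fin 4 → ℝ) (a b : Coord) :
    contr (fun i j => ∑ c, ∑ d, P i c * R j d * B c d) a b
      = contr B (fun c => ∑ i, P i c * a i) (fun d => ∑ j, R j d * b j) := by
  simp only [contr, Finset.sum_mul, Finset.mul_sum]
  rw [sum_comm_pairs]
  refine Finset.sum_congr rfl fun c _ => Finset.sum_congr rfl fun d _ => ?_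
  rw [Finset.sum_comm]
  exact Finset.sum_congr rfl fun j _ => Finset.sum_congr rfl fun i _ => by ring

/-- The projection in `D_a v_b` acts on the vectors it is contracted with. -/
lemma contr_projNabla (u v : Coord → Coord) (x a b : Coord) :
    contr (fun i j => M.projNabla u v i j x) a b
      = M.nab v x (a + M.ip x a (u x) • u x) (b + M.ip x b (u x) • u x) := by
  have := contr_mixed (fun i c => M.hMixed u i c x) (fun i c => M.hMixed u i c x)
    (fun c d => M.nabla v c d x) a b
  simp only [sum_hMixed] at this
  exact this

end Spacetime

end LRS

/-! ### The structure equations of an LRS-II spacetime -/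

namespace LRS

namespace LRSII

variable {Λ : ℝ} {L : LRSII Λ} {p : Coord}

lemma contDiffAt_u (hp : p ∈ L.domain) : ContDiffAt ℝ 2 L.u p :=
  L.contDiffOn_u.contDiffAt (L.isOpen_domain.mem_nhds hp)

lemma contDiffAt_e (hp : p ∈ L.domain) : ContDiffAt ℝ 2 L.e p :=
  L.contDiffOn_e.contDiffAt (L.isOpen_domain.mem_nhds hp)

lemma differentiableAt_u (hp : p ∈ L.domain) : DifferentiableAt ℝ L.u p :=
  (contDiffAt_u hp).differentiableAt (by norm_num)

lemma differentiableAt_e (hp : p ∈ L.domain) : DifferentiableAt ℝ L.e p :=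
  (contDiffAt_e hp).differentiableAt (by norm_num)

/-- The sheet expansion `N^{ab} ∇_a u_b = (2/3) Θ - Σ` of the congruence `u`. -/
def sheetTheta (L : LRSII Λ) (x : Coord) : ℝ := 2 / 3 * L.Theta x - L.Sigma x

/-- The connection form `K_a = e^b ∇_a u_b`, applied to the vector `a`. -/
def conn (L : LRSII Λ) (x a : Coord) : ℝ := L.nab L.u x a (L.e x)

/-- The sheet metric `N_{ab} = g_{ab} + u_a u_b - e_a e_b`, applied to `a` and `b`. -/
def sheetIp (L : LRSII Λ) (x a b : Coord) : ℝ :=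
  L.ip x a b + L.ip x a (L.u x) * L.ip x b (L.u x) - L.ip x a (L.e x) * L.ip x b (L.e x)

/-- `∇u` and `∇e` are invariant under the rotation `s ↦ t`, `t ↦ -s` of the sheet. Hence their mixed
components between the sheet and `u`, `e` vanish, and their sheet part is a trace part plus an
antisymmetric part. -/
lemma exists_isotropic_frame (hp : p ∈ L.domain) :
    ∃ s t, L.IsSheetBasis L.u L.e p s t ∧ ∀ v, v = L.u ∨ v = L.e →
      L.nab v p (L.u p) s = 0 ∧ L.nab v p (L.u p) t = 0 ∧
      L.nab v p (L.e p) s = 0 ∧ L.nab v p (L.e p) t = 0 ∧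
      L.nab v p s (L.e p) = 0 ∧ L.nab v p t (L.e p) = 0 ∧
      L.nab v p t s = -L.nab v p s t ∧ L.nab v p t t = L.nab v p s s := by
  obtain ⟨s, t, hst, hrot⟩ := L.symmetric p hp
  obtain ⟨V, f, hf, hs, ht⟩ := hrot (Real.pi / 2)
  simp only [Real.cos_pi_div_two, Real.sin_pi_div_two, zero_smul, one_smul, zero_add,
    neg_smul, add_zero] at hs ht
  refine ⟨s, t, hst, fun v hv => ?_⟩
  obtain ⟨-, hpV, -, -, -, hfp, -, hfu, hfe⟩ := id hf
  have hJu : fderiv ℝ f p (L.u p) = L.u p := by rw [hfu p hpV, hfp]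
  have hJe : fderiv ℝ f p (L.e p) = L.e p := by rw [hfe p hpV, hfp]
  have key (a b : Coord) : L.nab v p (fderiv ℝ f p a) (fderiv ℝ f p b) = L.nab v p a b := by
    rcases hv with rfl | rfl
    · exact hf.nab_map (differentiableAt_u hp) hfu a b
    · exact hf.nab_map (differentiableAt_e hp) hfe a b
  have hnl (a b : Coord) : L.nab v p (-a) b = -L.nab v p a b := contr_neg_left _ _ _
  have hnr (a b : Coord) : L.nab v p a (-b) = -L.nab v p a b := contr_neg_right _ _ _
  have h1 := key (L.u p) s
  have h2 := key (L.u p) t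
  have h3 := key (L.e p) s
  have h4 := key (L.e p) t
  have h5 := key s (L.e p)
  have h6 := key t (L.e p)
  have h7 := key s t
  have h8 := key s s
  simp only [hJu, hJe, hs, ht, hnl, hnr] at h1 h2 h3 h4 h5 h6 h7 h8
  refine ⟨?_, ?_, ?_, ?_, ?_, ?_, ?_, ?_⟩ <;> linarith

lemma nab_u_u (hp : p ∈ L.domain) (a : Coord) : L.nab L.u p a (L.u p) = 0 := by
  have := Spacetime.nab_add_nab_eq_zero hp (differentiableAt_u hp) (differentiableAt_u hp)
    L.ip_u_u a
  linarith

lemma nab_e_e (hp : p ∈ L.domain) (a : Coord) : L.nab L.e p a (L.e p) = 0 := by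
  have := Spacetime.nab_add_nab_eq_zero hp (differentiableAt_e hp) (differentiableAt_e hp)
    L.ip_e_e a
  linarith

lemma nab_e_u (hp : p ∈ L.domain) (a : Coord) : L.nab L.e p a (L.u p) = -L.conn p a := by
  have := Spacetime.nab_add_nab_eq_zero hp (differentiableAt_u hp) (differentiableAt_e hp)
    L.ip_u_e a
  rw [conn]
  linarith

lemma accel_eq (x : Coord) : L.accel x = L.conn x (L.u x) := by
  simp only [accel, conn, Spacetime.nab, contr]
  exact Finset.sum_congr rfl fun a _ => Finset.sum_congr rfl fun b _ => by ring

open Spacetime in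
/-- The first-order structure of an LRS-II spacetime: `∇_a u_b = K_a e_b + ½ θ N_{ab}` and
`∇_a e_b = K_a u_b + ½ φ N_{ab}`, where `K` vanishes on the sheet. -/
lemma exists_frame (hp : p ∈ L.domain) :
    ∃ s t, L.IsSheetBasis L.u L.e p s t ∧ L.conn p s = 0 ∧ L.conn p t = 0 ∧
      L.conn p (L.e p) = 1 / 3 * L.Theta p + L.Sigma p ∧
      (∀ a b, L.nab L.u p a b
        = L.conn p a * L.ip p b (L.e p) + L.sheetTheta p / 2 * L.sheetIp p a b) ∧
      ∀ a b, L.nab L.e p a b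
        = L.conn p a * L.ip p b (L.u p) + L.phi p / 2 * L.sheetIp p a b := by
  obtain ⟨s, t, hst, hiso⟩ := exists_isotropic_frame hp
  obtain ⟨u1, u2, u3, u4, u5, u6, u7, u8⟩ := hiso L.u (.inl rfl)
  obtain ⟨e1, e2, e3, e4, e5, e6, e7, e8⟩ := hiso L.e (.inr rfl)
  have huu := L.ip_u_u p hp
  have hee := L.ip_e_e p hp
  have hue := L.ip_u_e p hp
  have heu : L.ip p (L.e p) (L.u p) = 0 := by rw [ip_symm hp, hue]
  obtain ⟨hss, htt, hst', hsu, hse, htu, hte⟩ := id hst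
  have hproj (v : Coord → Coord) {a b : Coord} (ha : L.ip p a (L.u p) = 0)
      (hb : L.ip p b (L.u p) = 0) :
      contr (fun i j => L.projNabla L.u v i j p) a b = L.nab v p a b := by
    rw [contr_projNabla, ha, hb]
    simp
  -- no vorticity and no twist: the antisymmetric parts vanish
  have ust : L.nab L.u p s t = 0 := by
    have h := contr_symm (L.vorticityFree p hp) s t
    rw [hproj _ hsu htu, hproj _ htu hsu] at h
    linarith
  have est : L.nab L.e p s t = 0 := by
    have h1 := contr_mixed (fun i c => L.sheetMixed L.u L.e i c p)
      (fun i c => L.sheetMixed L.u L.e i c p)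
      (fun c d => L.projNabla L.u L.e c d p - L.projNabla L.u L.e d c p) s t
    have hN {a : Coord} (ha : L.ip p a (L.u p) = 0) (ha' : L.ip p a (L.e p) = 0) :
        (fun c => ∑ i, L.sheetMixed L.u L.e i c p * a i) = a := by
      funext c
      simp only [Spacetime.sheetMixed, sub_mul, Finset.sum_sub_distrib, sum_hMixed, ha]
      have : ∑ i, L.lower L.e i p * L.e p c * a i = L.ip p a (L.e p) * L.e p c := by
        rw [← sum_lower, Finset.sum_mul]
        exact Finset.sum_congr rfl fun i _ => by ring
      rw [this, ha']
      simp
    rw [hN hsu hse, hN htu hte] at h1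
    have h2 : contr (fun c d => L.projNabla L.u L.e c d p - L.projNabla L.u L.e d c p) s t
        = contr (fun i j => L.projNabla L.u L.e i j p) s t
          - contr (fun i j => L.projNabla L.u L.e i j p) t s := by
      simp only [contr, sub_mul, Finset.sum_sub_distrib]
      congr 1
      rw [Finset.sum_comm]
      exact Finset.sum_congr rfl fun i _ => Finset.sum_congr rfl fun j _ => by ring
    rw [h2, hproj _ hsu htu, hproj _ htu hsu] at h1
    simp only [L.twistFree p hp] at h1
    simp only [contr, zero_mul, Finset.sum_const_zero] at h1
    linarith
  have htrace := sum_ginv_mul hp huu hee hue hst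
  -- the kinematical scalars in terms of frame components
  have hTheta : L.Theta p = L.nab L.u p (L.e p) (L.e p) + 2 * L.nab L.u p s s := by
    have h1 : L.Theta p = ∑ a, ∑ b, L.ginv p a b * L.projNabla L.u L.u a b p
        + contr (fun i j => L.projNabla L.u L.u i j p) (L.u p) (L.u p) := by
      simp only [Theta, Spacetime.hUp, contr, ← Finset.sum_add_distrib]
      exact Finset.sum_congr rfl fun i _ => Finset.sum_congr rfl fun j _ => by ring
    rw [h1, htrace, hproj _ heu heu, hproj _ hsu hsu, hproj _ htu htu, u8]
    ring
  have hSigma : L.Sigma p = L.nab L.u p (L.e p) (L.e p) - 1 / 3 * L.Theta p := by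
    have h1 : L.Sigma p = contr (fun i j => L.projNabla L.u L.u i j p) (L.e p) (L.e p)
        - 1 / 3 * L.Theta p * (L.ip p (L.e p) (L.e p)
          + (∑ i, L.lower L.u i p * L.e p i) * ∑ i, L.lower L.u i p * L.e p i) := by
      rw [← contr_prod, ip_eq_contr]
      simp only [Sigma, shear, Spacetime.hDown, contr, ← Finset.sum_add_distrib,
        Finset.mul_sum, ← Finset.sum_sub_distrib]
      refine Finset.sum_congr rfl fun i _ => Finset.sum_congr rfl fun j _ => ?_
      rw [L.vorticityFree p hp j i]
      ring
    rw [h1, sum_lower, heu, hee, hproj _ heu heu]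
    ring
  have hphi : L.phi p = 2 * L.nab L.e p s s := by
    have h1 : L.phi p = ∑ a, ∑ b, L.ginv p a b * L.projNabla L.u L.e a b p
        + contr (fun i j => L.projNabla L.u L.e i j p) (L.u p) (L.u p)
        - contr (fun i j => L.projNabla L.u L.e i j p) (L.e p) (L.e p) := by
      simp only [phi, Spacetime.sheetUp, Spacetime.hUp, contr, ← Finset.sum_add_distrib,
        ← Finset.sum_sub_distrib]
      exact Finset.sum_congr rfl fun i _ => Finset.sum_congr rfl fun j _ => by ring
    rw [h1, htrace, hproj _ hsu hsu, hproj _ htu htu, e8]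
    ring
  refine ⟨s, t, hst, u5, u6, ?_, fun a b => ?_, fun a b => ?_⟩
  · rw [conn, hSigma]
    ring
  · have hc : L.nab L.u p s s = L.sheetTheta p / 2 := by
      rw [sheetTheta, hSigma, hTheta]
      ring
    refine (contr_eq_of_isotropic hp huu hee hue hst u1 u2 u3 u4 ust
      (show L.nab L.u p t s = 0 by linarith) hc (u8.trans hc) a b).trans ?_
    change -_ * L.nab L.u p a (L.u p) + _ * L.nab L.u p a (L.e p) + _ = _
    rw [nab_u_u hp, sheetIp, conn]
    ring
  · have hc : L.nab L.e p s s = L.phi p / 2 := by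
      rw [hphi]
      ring
    refine (contr_eq_of_isotropic hp huu hee hue hst e1 e2 e3 e4 est
      (show L.nab L.e p t s = 0 by linarith) hc (e8.trans hc) a b).trans ?_
    change -_ * L.nab L.e p a (L.u p) + _ * L.nab L.e p a (L.e p) + _ = _
    rw [nab_e_e hp, nab_e_u hp, sheetIp]
    ring

end LRSII

end LRS

/-! ### The Ricci identity and the symmetries of the Riemann tensor -/

namespace LRS

lemma fderiv_contr_eq_sum {B : Coord → Fin 4 → Fin 4 → ℝ} {p : Coord}
    (hB : ∀ i j, DifferentiableAt ℝ (fun y => B y i j) p) (z v w : Coord) :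
    fderiv ℝ (fun y => contr (B y) v w) p z
      = ∑ i, ∑ j, ∑ k, pd i (fun y => B y j k) p * z i * v j * w k := by
  rw [(fderiv_contr (fun i j => (hB i j).hasFDerivAt)
    (hasFDerivAt_const v p) (hasFDerivAt_const w p)).2, ← Finset.sum_comm_cycle]
  simp only [contr, zero_apply, Pi.zero_apply, mul_zero, zero_mul, Finset.sum_const_zero, add_zero]
  refine Finset.sum_congr rfl fun a _ => Finset.sum_congr rfl fun b _ => ?_
  rw [← sum_pd, Finset.sum_mul, Finset.sum_mul]
  exact Finset.sum_congr rfl fun i _ => by ring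

namespace Spacetime

variable {M : Spacetime} {p : Coord}

/-- The value `R_{abcd} a^a b^b c^c d^d` of the Riemann tensor. -/
def riem (M : Spacetime) (x a b c d : Coord) : ℝ :=
  ∑ i, ∑ j, ∑ k, ∑ l, M.riemann i j k l x * a i * b j * c k * d l

lemma differentiableAt_ginv (hp : p ∈ M.domain) (a b : Fin 4) :
    DifferentiableAt ℝ (fun y => M.ginv y a b) p := by
  have hdet {A : Coord → Matrix (Fin 4) (Fin 4) ℝ}
      (hA : ∀ i j, DifferentiableAt ℝ (fun y => A y i j) p) :
      DifferentiableAt ℝ (fun y => (A y).det) p := by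
    simp only [Matrix.det_apply', Fin.prod_univ_four]
    exact DifferentiableAt.fun_sum fun σ _ => (differentiableAt_const _).mul
      ((((hA _ _).mul (hA _ _)).mul (hA _ _)).mul (hA _ _))
  simp only [ginv, Matrix.inv_def, Matrix.smul_apply, smul_eq_mul, Ring.inverse_eq_inv',
    Matrix.adjugate_apply]
  refine DifferentiableAt.mul ?_ (hdet fun i j => ?_)
  · exact (hdet (differentiableAt_g hp)).inv (isUnit_det_g hp).ne_zero
  · simp only [Matrix.updateRow_apply]
    split_ifs
    · exact differentiableAt_const _
    · exact differentiableAt_g hp i j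

lemma differentiableAt_christoffel (hp : p ∈ M.domain) (c a b : Fin 4) :
    DifferentiableAt ℝ (M.christoffel c a b) p := by
  unfold christoffel
  refine (differentiableAt_const _).mul (DifferentiableAt.fun_sum fun d _ => ?_)
  have h (i j k : Fin 4) := differentiableAt_pd (contDiffAt_g hp j k) i
  exact (differentiableAt_ginv hp c d).mul (((h a b d).add (h b d a)).sub (h d a b))

lemma contDiffAt_lower {v : Coord → Coord} (hp : p ∈ M.domain) (hv : ContDiffAt ℝ 2 v p)
    (a : Fin 4) : ContDiffAt ℝ 2 (M.lower v a) p :=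
  ContDiffAt.sum fun b _ => (contDiffAt_g hp a b).mul (contDiffAt_pi.1 hv b)

lemma differentiableAt_nabla {v : Coord → Coord} (hp : p ∈ M.domain) (hv : ContDiffAt ℝ 2 v p)
    (a b : Fin 4) : DifferentiableAt ℝ (M.nabla v a b) p :=
  (differentiableAt_pd (contDiffAt_lower hp hv b) a).sub (DifferentiableAt.fun_sum fun c _ =>
    (differentiableAt_christoffel hp c a b).mul
      ((contDiffAt_lower hp hv c).differentiableAt (by norm_num)))

/-- The Ricci identity in components. -/
lemma pd_nabla_sub {v : Coord → Coord} (hp : p ∈ M.domain) (hv : ContDiffAt ℝ 2 v p)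
    (a b c : Fin 4) :
    pd a (M.nabla v b c) p - ∑ k, M.christoffel k a c p * M.nabla v b k p
      - (pd b (M.nabla v a c) p - ∑ k, M.christoffel k b c p * M.nabla v a k p)
      = -∑ k, M.riemannUp k c a b p * M.lower v k p := by
  have hl (k : Fin 4) : DifferentiableAt ℝ (M.lower v k) p :=
    (contDiffAt_lower hp hv k).differentiableAt (by norm_num)
  have h (a b : Fin 4) : pd a (M.nabla v b c) p = pd a (pd b (M.lower v c)) p
      - ∑ k, (M.christoffel k b c p * pd a (M.lower v k) p
        + M.lower v k p * pd a (M.christoffel k b c) p) := by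
    unfold nabla
    rw [pd, fderiv_fun_sub (f := pd b (M.lower v c))
      (g := fun x => ∑ k, M.christoffel k b c x * M.lower v k x)
      (differentiableAt_pd (contDiffAt_lower hp hv c) b)
      (DifferentiableAt.fun_sum fun k _ => (differentiableAt_christoffel hp k b c).mul (hl k)),
      fderiv_fun_sum (A := fun k x => M.christoffel k b c x * M.lower v k x)
        fun k _ => (differentiableAt_christoffel hp k b c).mul (hl k),
      sub_apply, sum_apply]
    congr 1
    refine Finset.sum_congr rfl fun k _ => ?_
    rw [fderiv_fun_mul (differentiableAt_christoffel hp k b c) (hl k)]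
    simp [pd]
  rw [h, h, pd_symm (contDiffAt_lower hp hv c) a b]
  simp only [nabla, riemannUp, Fin.sum_univ_four]
  ring

lemma sum_riemannUp_lower (hp : p ∈ M.domain) (v : Coord → Coord) (j k l : Fin 4) :
    ∑ m, M.riemannUp m j k l p * M.lower v m p = ∑ i, M.riemann i j k l p * v p i := by
  simp only [lower, riemann, Finset.mul_sum, Finset.sum_mul]
  rw [Finset.sum_comm]
  refine Finset.sum_congr rfl fun i _ => Finset.sum_congr rfl fun m _ => ?_
  rw [g_symm hp m i]
  ring

/-- The Ricci identity `∇_a ∇_b v_c - ∇_b ∇_a v_c = -R_{dcab} v^d`, contracted with constant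
vectors. The Christoffel terms for the pair `a`, `b` cancel and are left out. -/
lemma ricci_identity {v : Coord → Coord} (hp : p ∈ M.domain) (hv : ContDiffAt ℝ 2 v p)
    (a b c : Coord) :
    fderiv ℝ (fun y => M.nab v y b c) p a - M.nab v p b (M.chr p a c)
      - (fderiv ℝ (fun y => M.nab v y a c) p b - M.nab v p a (M.chr p b c))
      = -M.riem p (v p) c a b := by
  have h1 (a b : Coord) : fderiv ℝ (fun y => M.nab v y b c) p a
      = ∑ i, ∑ j, ∑ k, pd i (M.nabla v j k) p * a i * b j * c k :=
    fderiv_contr_eq_sum (differentiableAt_nabla hp hv) a b c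
  have h2 (a b : Coord) : M.nab v p b (M.chr p a c)
      = ∑ i, ∑ j, ∑ k, (∑ m, M.christoffel m i k p * M.nabla v j m p) * a i * b j * c k := by
    simp only [nab, chr, contr, Finset.mul_sum, Finset.sum_mul]
    symm
    rw [Finset.sum_comm]
    refine Finset.sum_congr rfl fun j _ => ?_
    rw [Finset.sum_comm_cycle]
    exact Finset.sum_congr rfl fun m _ => Finset.sum_congr rfl fun i _ =>
      Finset.sum_congr rfl fun k _ => by ring
  have h3 : M.riem p (v p) c a b
      = ∑ i, ∑ j, ∑ k, (∑ m, M.riemannUp m k i j p * M.lower v m p) * a i * b j * c k := by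
    simp only [sum_riemannUp_lower hp, riem, Finset.sum_mul]
    rw [sum_comm_pairs]
    refine Finset.sum_congr rfl fun i _ => Finset.sum_congr rfl fun j _ => ?_
    rw [Finset.sum_comm]
    exact Finset.sum_congr rfl fun k _ => Finset.sum_congr rfl fun m _ => by ring
  have hswap (F : Fin 4 → Fin 4 → Fin 4 → ℝ) : ∑ i, ∑ j, ∑ k, F i j k * b i * a j * c k
      = ∑ i, ∑ j, ∑ k, F j i k * a i * b j * c k := by
    rw [Finset.sum_comm]
    exact Finset.sum_congr rfl fun i _ => Finset.sum_congr rfl fun j _ =>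
      Finset.sum_congr rfl fun k _ => by ring
  rw [h1, h1, h2, h2, h3, hswap, hswap]
  simp only [← Finset.sum_sub_distrib, ← Finset.sum_neg_distrib]
  refine Finset.sum_congr rfl fun i _ => Finset.sum_congr rfl fun j _ =>
    Finset.sum_congr rfl fun k _ => ?_
  linear_combination (a i * b j * c k) * pd_nabla_sub hp hv i j k

section symmetries

variable (a b c d a' b' : Coord)

lemma riem_add_left : M.riem p (a + a') b c d = M.riem p a b c d + M.riem p a' b c d := by
  simp only [riem, Pi.add_apply, mul_add, add_mul, Finset.sum_add_distrib]

lemma riem_add_right : M.riem p a (b + b') c d = M.riem p a b c d + M.riem p a b' c d := by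
  simp only [riem, Pi.add_apply, mul_add, add_mul, Finset.sum_add_distrib]

lemma riem_antisymm_right : M.riem p a b d c = -M.riem p a b c d := by
  simp only [riem, ← Finset.sum_neg_distrib]
  refine Finset.sum_congr rfl fun i _ => Finset.sum_congr rfl fun j _ => ?_
  rw [Finset.sum_comm]
  refine Finset.sum_congr rfl fun k _ => Finset.sum_congr rfl fun l _ => ?_
  have : M.riemann i j l k p = -M.riemann i j k l p := by
    simp only [riemann, riemannUp, Fin.sum_univ_four]
    ring
  rw [this]
  ring

/-- `R_{abcd} v^a v^b = 0`: the Ricci identity for the field with the constant components `v`,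
contracted with `v`, where `v^b ∇_a v_b = ½ ∂_a (v^b v_b)` and partial derivatives commute. -/
lemma riem_self (hp : p ∈ M.domain) : M.riem p a a c d = 0 := by
  have hc {y : Coord} : DifferentiableAt ℝ (fun _ : Coord => a) y := differentiableAt_const a
  have hnab (z : Coord) {y : Coord} (hy : y ∈ M.domain) :
      M.nab (fun _ => a) y z a = 1 / 2 * fderiv ℝ (fun y => M.ip y a a) y z := by
    rw [fderiv_ip_eq_nab hy hc hc]
    ring
  have hip : ContDiffAt ℝ 2 (fun y => M.ip y a a) p :=
    ContDiffAt.sum fun i _ => ContDiffAt.sum fun j _ =>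
      ((contDiffAt_g hp i j).mul contDiffAt_const).mul contDiffAt_const
  have hd : DifferentiableAt ℝ (fderiv ℝ fun y => M.ip y a a) p :=
    (hip.fderiv_right (m := 1) (by norm_num)).differentiableAt (by norm_num)
  have hs : IsSymmSndFDerivAt ℝ (fun y => M.ip y a a) p := hip.isSymmSndFDerivAt (by simp)
  have h1 (z w : Coord) : fderiv ℝ (fun y => M.nab (fun _ => a) y w a) p z
      = 1 / 2 * fderiv ℝ (fderiv ℝ fun y => M.ip y a a) p z w := by
    rw [Filter.EventuallyEq.fderiv_eq ((eventually_mem hp).mono fun y hy => hnab w hy),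
      fderiv_const_mul (hd.clm_apply (differentiableAt_const _)),
      smul_apply, fderiv_clm_apply hd (differentiableAt_const _)]
    simp
  have h2 (z w : Coord) : M.nab (fun _ => a) p w (M.chr p z a)
      = M.ip p (M.chr p w a) (M.chr p z a) := by
    rw [nab_eq_ip hp hc]
    simp
  have := ricci_identity hp (contDiffAt_const (c := a)) c d a
  rw [h1, h1, h2, h2, hs.eq c d, ip_symm hp (M.chr p d a)] at this
  linarith

lemma riem_antisymm_left (hp : p ∈ M.domain) : M.riem p b a c d = -M.riem p a b c d := by
  have := riem_self (a + b) c d hp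
  rw [riem_add_left, riem_add_right, riem_add_right, riem_self a c d hp, riem_self b c d hp]
    at this
  linarith

/-- The first Bianchi identity. -/
lemma riem_bianchi (hp : p ∈ M.domain) :
    M.riem p a b c d + M.riem p a c d b + M.riem p a d b c = 0 := by
  have hpd (i j k l : Fin 4) : pd i (M.christoffel j k l) p = pd i (M.christoffel j l k) p := by
    rw [pd, pd, Filter.EventuallyEq.fderiv_eq
      ((eventually_mem hp).mono fun y hy => christoffel_symm hy j k l)]
  have hup (i j k l : Fin 4) :
      M.riemannUp i j k l p + M.riemannUp i k l j p + M.riemannUp i l j k p = 0 := by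
    simp only [riemannUp, hpd l i k j, hpd k i j l, hpd j i k l, Fin.sum_univ_four,
      fun m => christoffel_symm hp m k j, fun m => christoffel_symm hp m j l,
      fun m => christoffel_symm hp m k l]
    ring
  have hdown (i j k l : Fin 4) :
      M.riemann i j k l p + M.riemann i k l j p + M.riemann i l j k p = 0 := by
    simp only [riemann, ← Finset.sum_add_distrib, ← mul_add, hup, mul_zero, Finset.sum_const_zero]
  have h1 : M.riem p a c d b
      = ∑ i, ∑ j, ∑ k, ∑ l, M.riemann i k l j p * a i * b j * c k * d l := by
    refine Finset.sum_congr rfl fun i _ => ?_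
    rw [Finset.sum_comm_cycle]
    exact Finset.sum_congr rfl fun j _ => Finset.sum_congr rfl fun k _ =>
      Finset.sum_congr rfl fun l _ => by ring
  have h2 : M.riem p a d b c
      = ∑ i, ∑ j, ∑ k, ∑ l, M.riemann i l j k p * a i * b j * c k * d l := by
    refine Finset.sum_congr rfl fun i _ => ?_
    rw [← Finset.sum_comm_cycle]
    exact Finset.sum_congr rfl fun j _ => Finset.sum_congr rfl fun k _ =>
      Finset.sum_congr rfl fun l _ => by ring
  rw [h1, h2]
  simp only [riem, ← Finset.sum_add_distrib, ← add_mul, hdown, zero_mul, Finset.sum_const_zero]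

lemma riem_pair_symm (hp : p ∈ M.domain) : M.riem p c d a b = M.riem p a b c d := by
  have b1 := riem_bianchi a b c d hp
  have b2 := riem_bianchi b c d a hp
  have b3 := riem_bianchi c d a b hp
  have b4 := riem_bianchi d a b c hp
  have r := @riem_antisymm_right M p
  have l := @riem_antisymm_left M p
  have e1 := l a c d b hp
  have e2 := l a d b c hp
  have e3 := l b c d a hp
  have e4 := l b d a c hp
  have e5 := l a b c d hp
  have e6 := l c d a b hp
  have f1 := r b d a c
  have f2 := r a c d b
  have f3 := r c a b d
  have f4 := r d b c a
  have f5 := r b a c d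
  have f6 := r d c a b
  have f7 := r b c d a
  have f8 := r a d b c
  have f9 := r c b a d
  have f10 := r d a b c
  have f11 := r a b c d
  have f12 := r c d a b
  have e7 := l b c a d hp
  have e8 := l a d c b hp
  have e9 := l a c b d hp
  have e10 := l b d c a hp
  linarith

end symmetries

end Spacetime

end LRS

/-! ### The Ricci identity in an LRS-II spacetime -/

namespace LRS

namespace LRSII

open Spacetime

variable {Λ : ℝ} {L : LRSII Λ} {p : Coord}

section differentiability

lemma differentiableAt_nabla_u (hp : p ∈ L.domain) (a b : Fin 4) :
    DifferentiableAt ℝ (L.nabla L.u a b) p := differentiableAt_nabla hp (contDiffAt_u hp) a b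

lemma differentiableAt_u_apply (hp : p ∈ L.domain) (a : Fin 4) :
    DifferentiableAt ℝ (fun x => L.u x a) p := differentiableAt_pi.1 (differentiableAt_u hp) a

lemma differentiableAt_e_apply (hp : p ∈ L.domain) (a : Fin 4) :
    DifferentiableAt ℝ (fun x => L.e x a) p := differentiableAt_pi.1 (differentiableAt_e hp) a

lemma differentiableAt_lower_u (hp : p ∈ L.domain) (a : Fin 4) :
    DifferentiableAt ℝ (L.lower L.u a) p :=
  (contDiffAt_lower hp (contDiffAt_u hp) a).differentiableAt (by norm_num)

lemma differentiableAt_hMixed (hp : p ∈ L.domain) (a b : Fin 4) :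
    DifferentiableAt ℝ (L.hMixed L.u a b) p :=
  (differentiableAt_const _).add ((differentiableAt_lower_u hp a).mul
    (differentiableAt_u_apply hp b))

lemma differentiableAt_hUp (hp : p ∈ L.domain) (a b : Fin 4) :
    DifferentiableAt ℝ (L.hUp L.u a b) p :=
  (differentiableAt_ginv hp a b).add ((differentiableAt_u_apply hp a).mul
    (differentiableAt_u_apply hp b))

lemma differentiableAt_projNabla {v : Coord → Coord} (hp : p ∈ L.domain)
    (hv : ContDiffAt ℝ 2 v p) (a b : Fin 4) : DifferentiableAt ℝ (L.projNabla L.u v a b) p :=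
  DifferentiableAt.fun_sum fun c _ => DifferentiableAt.fun_sum fun d _ =>
    ((differentiableAt_hMixed hp a c).mul (differentiableAt_hMixed hp b d)).mul
      (differentiableAt_nabla hp hv c d)

lemma differentiableAt_Theta (hp : p ∈ L.domain) : DifferentiableAt ℝ L.Theta p :=
  DifferentiableAt.fun_sum fun a _ => DifferentiableAt.fun_sum fun b _ =>
    (differentiableAt_hUp hp a b).mul (differentiableAt_projNabla hp (contDiffAt_u hp) a b)

lemma differentiableAt_phi (hp : p ∈ L.domain) : DifferentiableAt ℝ L.phi p :=
  DifferentiableAt.fun_sum fun a _ => DifferentiableAt.fun_sum fun b _ =>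
    ((differentiableAt_hUp hp a b).sub ((differentiableAt_e_apply hp a).mul
      (differentiableAt_e_apply hp b))).mul (differentiableAt_projNabla hp (contDiffAt_e hp) a b)

lemma differentiableAt_Sigma (hp : p ∈ L.domain) : DifferentiableAt ℝ L.Sigma p := by
  have hP := differentiableAt_projNabla hp (contDiffAt_u hp)
  refine DifferentiableAt.fun_sum fun a _ => DifferentiableAt.fun_sum fun b _ =>
    ((differentiableAt_e_apply hp a).mul (differentiableAt_e_apply hp b)).mul ?_
  exact (((hP a b).add (hP b a)).const_mul _).sub
    (((differentiableAt_Theta hp).const_mul _).mul ((differentiableAt_g hp a b).add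
      ((differentiableAt_lower_u hp a).mul (differentiableAt_lower_u hp b))))

lemma differentiableAt_sheetTheta (hp : p ∈ L.domain) : DifferentiableAt ℝ L.sheetTheta p :=
  ((differentiableAt_Theta hp).const_mul _).sub (differentiableAt_Sigma hp)

lemma differentiableAt_conn (hp : p ∈ L.domain) (a : Coord) :
    DifferentiableAt ℝ (fun y => L.conn y a) p :=
  (fderiv_contr (fun i j => (differentiableAt_nabla_u hp i j).hasFDerivAt)
    (hasFDerivAt_const a p) (differentiableAt_e hp).hasFDerivAt).1

end differentiability

/-- The structure equation `∇_a v_b = K_a v'_b + ½ ψ N_{ab}` inserted into the Ricci identity for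
`v`, contracted with `w^a s^b s^c` for a unit sheet vector `s` and `w` orthogonal to `s`. The two
cases are `v = u`, `v' = e`, `ψ = θ`, `ψ' = φ` and `v = e`, `v' = u`, `ψ = φ`, `ψ' = θ`. Only `ψ` is
differentiated in the result: the derivative of `K` is multiplied by `v'_c s^c = 0`. -/
lemma fderiv_sheet_expansion (hp : p ∈ L.domain) {v v' : Coord → Coord} {ψ : Coord → ℝ} {ψ' : ℝ}
    {s : Coord} (hv : ContDiffAt ℝ 2 v p) (hv' : DifferentiableAt ℝ v' p)
    (hψ : DifferentiableAt ℝ ψ p)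
    (hnab : ∀ y ∈ L.domain, ∀ a b,
      L.nab v y a b = L.conn y a * L.ip y b (v' y) + ψ y / 2 * L.sheetIp y a b)
    (hss : L.ip p s s = 1) (hsu : L.ip p s (L.u p) = 0) (hse : L.ip p s (L.e p) = 0)
    (hsv : L.ip p s (v' p) = 0) (hK : L.conn p s = 0)
    (hnv : L.nab v' p s s = ψ' / 2) (hnu : L.nab L.u p s s = L.sheetTheta p / 2)
    (hne : L.nab L.e p s s = L.phi p / 2) {w : Coord} (hws : L.ip p w s = 0) :
    1 / 2 * fderiv ℝ ψ p w - L.conn p w * ψ' / 2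
      - ψ p / 2 * (L.ip p w (L.u p) * L.sheetTheta p / 2 - L.ip p w (L.e p) * L.phi p / 2)
      = -L.riem p (v p) s w s := by
  have hip {z : Coord → Coord} (hz : DifferentiableAt ℝ z p) (b : Coord) :
      DifferentiableAt ℝ (fun y => L.ip y b (z y)) p :=
    (fderiv_ip hp (differentiableAt_const b) hz).1
  have hu := hip (differentiableAt_u hp)
  have he := hip (differentiableAt_e hp)
  have hg (a b : Coord) : DifferentiableAt ℝ (fun y => L.ip y a b) p :=
    hip (differentiableAt_const b) a
  have hD {z : Coord → Coord} (hz : DifferentiableAt ℝ z p) (a b : Coord) :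
      fderiv ℝ (fun y => L.ip y b (z y)) p a = L.nab z p a b + L.ip p (z p) (L.chr p a b) := by
    rw [nab_eq_fderiv hp hz]
    ring
  have key (z a b : Coord) : fderiv ℝ (fun y => L.nab v y a b) p z
      = fderiv ℝ (fun y => L.conn y a) p z * L.ip p b (v' p)
        + L.conn p a * (L.nab v' p z b + L.ip p (v' p) (L.chr p z b))
        + fderiv ℝ ψ p z / 2 * L.sheetIp p a b
        + ψ p / 2 * (L.dg p z a b
          + (L.nab L.u p z a + L.ip p (L.u p) (L.chr p z a)) * L.ip p b (L.u p)
          + L.ip p a (L.u p) * (L.nab L.u p z b + L.ip p (L.u p) (L.chr p z b))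
          - (L.nab L.e p z a + L.ip p (L.e p) (L.chr p z a)) * L.ip p b (L.e p)
          - L.ip p a (L.e p) * (L.nab L.e p z b + L.ip p (L.e p) (L.chr p z b))) := by
    rw [Filter.EventuallyEq.fderiv_eq ((eventually_mem hp).mono fun y hy => hnab y hy a b)]
    have h := (((differentiableAt_conn hp a).hasFDerivAt.mul (hip hv' b).hasFDerivAt).add
      ((hψ.hasFDerivAt.mul_const (2⁻¹ : ℝ)).mul (((hg a b).hasFDerivAt.add
        ((hu a).hasFDerivAt.mul (hu b).hasFDerivAt)).sub
        ((he a).hasFDerivAt.mul (he b).hasFDerivAt)))).fderiv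
    refine (congrArg (fun A : Coord →L[ℝ] ℝ => A z) h).trans ?_
    simp only [add_apply, sub_apply, smul_apply, smul_eq_mul, hD (differentiableAt_u hp),
      hD (differentiableAt_e hp), hD hv', fderiv_ip_const hp, sheetIp]
    simp only [Pi.add_apply, Pi.sub_apply, Pi.mul_apply]
    ring
  have hR := ricci_identity hp hv w s s
  rw [key, key, hnab p hp, hnab p hp] at hR
  simp only [sheetIp, hss, hsu, hse, hsv, hws, hK, hnv, hnu, hne, dg_eq_chr hp] at hR
  rw [chr_symm hp s w, ip_symm hp (L.chr p w s) s, ip_symm hp (L.chr p s s) (v' p),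
    ip_symm hp (L.chr p s s) (L.u p), ip_symm hp (L.chr p s s) (L.e p)] at hR
  linear_combination hR

end LRSII

end LRS

/-! ### The field equations and the evolution and propagation equations -/

namespace LRS

lemma sum_mul_contr_left (A B : Fin 4 → Fin 4 → ℝ) (v w v' w' : Coord) :
    ∑ a, ∑ b, ∑ c, ∑ d, A a b * B c d * v a * w b * v' c * w' d
      = contr A v w * contr B v' w' := by
  simp only [contr, Finset.sum_mul]
  simp only [Finset.mul_sum]
  exact Finset.sum_congr rfl fun a _ => Finset.sum_congr rfl fun b _ =>
    Finset.sum_congr rfl fun c _ => Finset.sum_congr rfl fun d _ => by ring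

lemma sum_mul_contr_cross (A B : Fin 4 → Fin 4 → ℝ) (v w v' w' : Coord) :
    ∑ a, ∑ b, ∑ c, ∑ d, A a d * B c b * v a * w b * v' c * w' d
      = contr A v w' * contr B v' w := by
  rw [← sum_mul_contr_left]
  refine Finset.sum_congr rfl fun a _ => ?_
  rw [Finset.sum_comm_cycle]
  refine Finset.sum_congr rfl fun d _ => ?_
  rw [Finset.sum_comm]
  exact Finset.sum_congr rfl fun c _ => Finset.sum_congr rfl fun b _ => by ring

/-- The contraction of an expression of the form of the Weyl tensor with `e`, `u`, `e`, `u`. -/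
lemma sum_weyl (F : Fin 4 → Fin 4 → Fin 4 → Fin 4 → ℝ) (g R : Fin 4 → Fin 4 → ℝ) (r : ℝ)
    (e u : Coord) :
    ∑ a, ∑ b, e a * e b * ∑ c, ∑ d, (F a c b d
        - 1 / 2 * (g a b * R c d - g a d * R c b - g c b * R a d + g c d * R a b)
        + r * (g a b * g c d - g a d * g c b)) * u c * u d
      = ∑ a, ∑ b, ∑ c, ∑ d, F a c b d * e a * u c * e b * u d
        - 1 / 2 * (contr g e e * contr R u u - contr g e u * contr R u e
          - contr R e u * contr g u e + contr R e e * contr g u u)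
        + r * (contr g e e * contr g u u - contr g e u * contr g u e) := by
  rw [← sum_mul_contr_left g R e e u u, ← sum_mul_contr_left R g e e u u,
    ← sum_mul_contr_left g g e e u u, ← sum_mul_contr_cross g R e e u u,
    ← sum_mul_contr_cross R g e e u u, ← sum_mul_contr_cross g g e e u u]
  simp only [Finset.mul_sum, ← Finset.sum_add_distrib, ← Finset.sum_sub_distrib]
  exact Finset.sum_congr rfl fun a _ => Finset.sum_congr rfl fun b _ =>
    Finset.sum_congr rfl fun c _ => Finset.sum_congr rfl fun d _ => by ring

lemma sum_mul_sub_metric (X G : Fin 4 → Fin 4 → ℝ) (l v : Fin 4 → ℝ) (c : ℝ) :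
    ∑ a, ∑ b, v a * v b * (X a b - c * (G a b + l a * l b))
      = contr X v v - c * (contr G v v + (∑ a, l a * v a) * ∑ a, l a * v a) := by
  rw [← contr_prod]
  simp only [contr, ← Finset.sum_add_distrib, Finset.mul_sum, ← Finset.sum_sub_distrib]
  exact Finset.sum_congr rfl fun i _ => Finset.sum_congr rfl fun j _ => by ring

namespace Spacetime

variable {M : Spacetime} {p : Coord} {u e : Coord → Coord} {s t : Coord}

lemma ricci_eq_sum (hp : p ∈ M.domain) (a b : Fin 4) :
    M.ricci a b p = ∑ c, ∑ d, M.ginv p c d * M.riemann d a c b p := by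
  refine Finset.sum_congr rfl fun c _ => ?_
  have h : (M.ginv p).mulVec ((M.g p).mulVec fun k => M.riemannUp k a c b p) c
      = M.riemannUp c a c b p := by
    rw [Matrix.mulVec_mulVec, ginv, Matrix.nonsing_inv_mul _ (isUnit_det_g hp),
      Matrix.one_mulVec]
  exact h.symm

/-- The Ricci tensor as a trace of the Riemann tensor in an adapted orthonormal basis. -/
lemma contr_ricci (hp : p ∈ M.domain) (huu : M.ip p (u p) (u p) = -1)
    (hee : M.ip p (e p) (e p) = 1) (hue : M.ip p (u p) (e p) = 0)
    (hst : M.IsSheetBasis u e p s t) (v w : Coord) :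
    contr (fun a b => M.ricci a b p) v w = -M.riem p (u p) v (u p) w
      + M.riem p (e p) v (e p) w + M.riem p s v s w + M.riem p t v t w := by
  have h (z : Coord) : M.riem p z v z w
      = ∑ a, ∑ b, contr (fun c d => M.riemann d a c b p) z z * v a * w b := by
    simp only [riem, contr, Finset.sum_mul]
    conv_rhs => rw [sum_comm_pairs, Finset.sum_comm]
    refine Finset.sum_congr rfl fun i _ => ?_
    rw [Finset.sum_comm]
    exact Finset.sum_congr rfl fun k _ => Finset.sum_congr rfl fun j _ =>
      Finset.sum_congr rfl fun l _ => by ring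
  rw [h, h, h, h]
  simp only [ricci_eq_sum hp, sum_ginv_mul hp huu hee hue hst]
  rw [contr]
  simp only [← Finset.sum_neg_distrib, ← Finset.sum_add_distrib]
  exact Finset.sum_congr rfl fun i _ => Finset.sum_congr rfl fun j _ => by ring

end Spacetime

namespace LRSII

open Spacetime

variable {Λ : ℝ} {L : LRSII Λ} {p : Coord} {s t : Coord}

lemma contr_T (hp : p ∈ L.domain) (v w : Coord) :
    contr (L.T p) v w = contr (fun a b => L.ricci a b p) v w
      - 1 / 2 * L.scalarCurv p * L.ip p v w + Λ * L.ip p v w := by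
  simp only [contr, Spacetime.ip, Finset.mul_sum, ← Finset.sum_add_distrib,
    ← Finset.sum_sub_distrib, ← L.einstein p hp]
  exact Finset.sum_congr rfl fun i _ => Finset.sum_congr rfl fun j _ => by ring

lemma electric_eq (hp : p ∈ L.domain) :
    L.electric p = L.riem p (L.e p) (L.u p) (L.e p) (L.u p)
      - 1 / 2 * (contr (fun a b => L.ricci a b p) (L.u p) (L.u p)
        - contr (fun a b => L.ricci a b p) (L.e p) (L.e p))
      - L.scalarCurv p / 6 := by
  have h := sum_weyl (fun a c b d => L.riemann a c b d p) (L.g p) (fun a b => L.ricci a b p)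
    (L.scalarCurv p / 6) (L.e p) (L.u p)
  change L.electric p = _ at h
  have hr : L.riem p (L.e p) (L.u p) (L.e p) (L.u p) = ∑ a, ∑ b, ∑ c, ∑ d,
      L.riemann a c b d p * L.e p a * L.u p c * L.e p b * L.u p d :=
    Finset.sum_congr rfl fun a _ => Finset.sum_comm
  rw [h, hr]
  simp only [← ip_eq_contr, L.ip_u_u p hp, L.ip_e_e p hp, L.ip_u_e p hp,
    ip_symm hp (L.e p) (L.u p)]
  ring

lemma mu_eq (x : Coord) : L.mu x = contr (L.T x) (L.u x) (L.u x) := rfl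

lemma pressure_eq (hp : p ∈ L.domain) (hst : L.IsSheetBasis L.u L.e p s t) :
    L.pressure p
      = 1 / 3 * (contr (L.T p) (L.e p) (L.e p) + contr (L.T p) s s + contr (L.T p) t t) := by
  have h : L.pressure p = 1 / 3 * (∑ a, ∑ b, L.ginv p a b * L.T p a b
      + contr (L.T p) (L.u p) (L.u p)) := by
    simp only [pressure, Spacetime.hUp, contr, ← Finset.sum_add_distrib]
    congr 1
    exact Finset.sum_congr rfl fun i _ => Finset.sum_congr rfl fun j _ => by ring
  have h' := sum_ginv_mul hp (L.ip_u_u p hp) (L.ip_e_e p hp) (L.ip_u_e p hp) hst (L.T p)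
  linarith

lemma hMixed_e (hp : p ∈ L.domain) :
    (fun c => ∑ i, L.hMixed L.u i c p * L.e p i) = L.e p := by
  funext c
  rw [sum_hMixed, ip_symm hp, L.ip_u_e p hp]
  simp

lemma Q_eq (hp : p ∈ L.domain) : L.Q p = -contr (L.T p) (L.e p) (L.u p) := by
  have h : L.Q p = -contr (L.T p) (fun c => ∑ i, L.hMixed L.u i c p * L.e p i) (L.u p) := by
    simp only [Q, heatFlux, contr, Finset.mul_sum, neg_mul, Finset.sum_mul,
      Finset.sum_neg_distrib]
    rw [← Finset.sum_comm_cycle]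
    congr 1
    exact Finset.sum_congr rfl fun i _ => Finset.sum_congr rfl fun j _ =>
      Finset.sum_congr rfl fun k _ => by ring
  rw [h, hMixed_e hp]

lemma Pi_eq (hp : p ∈ L.domain) :
    L.Pi p = contr (L.T p) (L.e p) (L.e p) - L.pressure p := by
  have h := contr_mixed (fun a c => L.hMixed L.u a c p) (fun b d => L.hMixed L.u b d p)
    (L.T p) (L.e p) (L.e p)
  rw [hMixed_e hp] at h
  refine (sum_mul_sub_metric _ (L.g p) (fun a => L.lower L.u a p) (L.e p)
    (L.pressure p)).trans ?_
  rw [h, ← ip_eq_contr, sum_lower, L.ip_e_e p hp, ip_symm hp, L.ip_u_e p hp]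
  ring

/-- Summing the contracted Ricci identities over an orthonormal basis of the sheet gives the
derivatives of `θ = (2/3) Θ - Σ` and `φ` along `u` and `e`. -/
lemma evolution_propagation (hp : p ∈ L.domain) :
    L.dot L.sheetTheta p = L.accel p * L.phi p - 1 / 2 * L.sheetTheta p ^ 2
        - 1 / 3 * (L.mu p + 3 * L.pressure p - 2 * Λ) + L.electric p - 1 / 2 * L.Pi p ∧
    L.hat L.sheetTheta p = 3 / 2 * L.phi p * L.Sigma p + L.Q p ∧
    L.dot L.phi p = L.sheetTheta p * (L.accel p - 1 / 2 * L.phi p) + L.Q p ∧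
    L.hat L.phi p = -(1 / 2) * L.phi p ^ 2
        + (1 / 3 * L.Theta p + L.Sigma p) * (2 / 3 * L.Theta p - L.Sigma p)
        - 2 / 3 * (L.mu p + Λ) - L.electric p - 1 / 2 * L.Pi p := by
  obtain ⟨s, t, hst, hKs, hKt, hKe, hnu, hne⟩ := exists_frame hp
  have huu := L.ip_u_u p hp
  have hee := L.ip_e_e p hp
  have hue := L.ip_u_e p hp
  have heu : L.ip p (L.e p) (L.u p) = 0 := by rw [ip_symm hp, hue]
  have hnabu : ∀ y ∈ L.domain, ∀ a b, L.nab L.u y a b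
      = L.conn y a * L.ip y b (L.e y) + L.sheetTheta y / 2 * L.sheetIp y a b := fun y hy => by
    obtain ⟨_, _, _, _, _, _, h, _⟩ := exists_frame hy
    exact h
  have hnabe : ∀ y ∈ L.domain, ∀ a b, L.nab L.e y a b
      = L.conn y a * L.ip y b (L.u y) + L.phi y / 2 * L.sheetIp y a b := fun y hy => by
    obtain ⟨_, _, _, _, _, _, _, h⟩ := exists_frame hy
    exact h
  have hR := contr_ricci hp huu hee hue hst
  have hT := contr_T hp
  have hpr := pressure_eq hp hst
  have hscal := sum_ginv_mul hp huu hee hue hst (fun a b => L.ricci a b p)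
  change L.scalarCurv p = _ at hscal
  have hE := electric_eq hp
  have hPi := Pi_eq hp
  have hmu := L.mu_eq p
  have hQ := Q_eq hp
  obtain ⟨hss, htt, hst', hsu, hse, htu, hte⟩ := hst
  -- the Ricci identities for `u` and `e`, for a unit vector `z` of the sheet
  have hu {z : Coord} (hzz : L.ip p z z = 1) (hzu : L.ip p z (L.u p) = 0)
      (hze : L.ip p z (L.e p) = 0) (hz : L.conn p z = 0) {w : Coord} (hw : L.ip p w z = 0) :
      1 / 2 * fderiv ℝ L.sheetTheta p w - L.conn p w * L.phi p / 2 - L.sheetTheta p / 2 *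
        (L.ip p w (L.u p) * L.sheetTheta p / 2 - L.ip p w (L.e p) * L.phi p / 2)
        = -L.riem p (L.u p) z w z :=
    fderiv_sheet_expansion hp (contDiffAt_u hp) (differentiableAt_e hp)
      (differentiableAt_sheetTheta hp) hnabu hzz hzu hze hze hz
      (by simp [hne, sheetIp, hzz, hzu, hze]) (by simp [hnu, sheetIp, hzz, hzu, hze])
      (by simp [hne, sheetIp, hzz, hzu, hze]) hw
  have he {z : Coord} (hzz : L.ip p z z = 1) (hzu : L.ip p z (L.u p) = 0)
      (hze : L.ip p z (L.e p) = 0) (hz : L.conn p z = 0) {w : Coord} (hw : L.ip p w z = 0) :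
      1 / 2 * fderiv ℝ L.phi p w - L.conn p w * L.sheetTheta p / 2 - L.phi p / 2 *
        (L.ip p w (L.u p) * L.sheetTheta p / 2 - L.ip p w (L.e p) * L.phi p / 2)
        = -L.riem p (L.e p) z w z :=
    fderiv_sheet_expansion hp (contDiffAt_e hp) (differentiableAt_u hp)
      (differentiableAt_phi hp) hnabe hzz hzu hze hzu hz
      (by simp [hnu, sheetIp, hzz, hzu, hze]) (by simp [hnu, sheetIp, hzz, hzu, hze])
      (by simp [hne, sheetIp, hzz, hzu, hze]) hw
  have hus : L.ip p (L.u p) s = 0 := by rw [ip_symm hp, hsu]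
  have hut : L.ip p (L.u p) t = 0 := by rw [ip_symm hp, htu]
  have hes : L.ip p (L.e p) s = 0 := by rw [ip_symm hp, hse]
  have het : L.ip p (L.e p) t = 0 := by rw [ip_symm hp, hte]
  have r1 := hu hss hsu hse hKs hus
  have r2 := hu htt htu hte hKt hut
  have r3 := hu hss hsu hse hKs hes
  have r4 := hu htt htu hte hKt het
  have r5 := he hss hsu hse hKs hus
  have r6 := he htt htu hte hKt hut
  have r7 := he hss hsu hse hKs hes
  have r8 := he htt htu hte hKt het
  rw [huu, hue, ← accel_eq] at r1 r2 r5 r6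
  rw [hee, heu, hKe] at r3 r4 r7 r8
  have hflip (a b c d : Coord) : L.riem p a b c d = L.riem p b a d c := by
    rw [riem_antisymm_left _ _ _ _ hp, riem_antisymm_right, neg_neg]
  have hz (a b c : Coord) : L.riem p a a b c = 0 := riem_self _ _ _ hp
  have hz' (a b c : Coord) : L.riem p b c a a = 0 := by
    rw [riem_pair_symm _ _ _ _ hp, hz]
  -- the sheet vector is moved to the slots traced over in the Ricci tensor
  rw [hflip] at r1 r2 r3 r4 r5 r6 r7 r8
  have hRuu := hR (L.u p) (L.u p)
  have hRee := hR (L.e p) (L.e p)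
  have hRue := hR (L.u p) (L.e p)
  have hReu := hR (L.e p) (L.u p)
  simp only [hz, hz'] at hRuu hRee hRue hReu
  rw [hflip (L.u p) (L.e p)] at hRee
  -- the Ricci tensor is symmetric
  have q1 := riem_pair_symm s (L.u p) s (L.e p) hp
  have q2 := riem_pair_symm t (L.u p) t (L.e p) hp
  have hTuu := hT (L.u p) (L.u p)
  have hTee := hT (L.e p) (L.e p)
  have hTeu := hT (L.e p) (L.u p)
  have hTss := hT s s
  have hTtt := hT t t
  rw [huu] at hTuu
  rw [hee] at hTee
  rw [heu] at hTeu
  rw [hss] at hTss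
  rw [htt] at hTtt
  simp only [dot, hat, dirDeriv_eq]
  simp only [sheetTheta] at *
  -- The trace of the field equations is `R = 4 Λ + μ - 3 p`; apart from it, every equation is the
  -- sum of the two Ricci identities over `s` and `t`, rewritten by the field equations.
  refine ⟨?_, ?_, ?_, ?_⟩
  · linarith
  · linarith
  · linarith
  · linarith

end LRSII

end LRS

/-! ### The matching constraint -/

namespace LRS

namespace LRSII

open Spacetime

variable {Λ ε : ℝ} {L : LRSII Λ} {Ξ : Set (Fin 3 → ℝ)} {X : (Fin 3 → ℝ) → Coord}
  {n : Coord → Coord} {x : Coord}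

lemma IsMatchingSurface.beta_sq (h : L.IsMatchingSurface ε Ξ X n) (hx : x ∈ L.domain) :
    L.beta n x ^ 2 = ε + L.alpha n x ^ 2 := by
  have h1 := h.norm_normal x hx
  rw [h.no_sheet_component x hx] at h1
  simp only [ip_add_left, ip_add_right, ip_smul_left, ip_smul_right, L.ip_u_u x hx,
    L.ip_e_e x hx, L.ip_u_e x hx, ip_symm hx (L.e x) (L.u x)] at h1
  linarith

lemma IsMatchingSurface.beta_eq (h : L.IsMatchingSurface ε Ξ X n) (hx : x ∈ L.domain) :
    L.beta n x = √(ε + L.alpha n x ^ 2) ∨ L.beta n x = -√(ε + L.alpha n x ^ 2) := by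
  rw [← h.beta_sq hx, Real.sqrt_sq_eq_abs]
  rcases abs_choice (L.beta n x) with h | h
  · exact .inl h.symm
  · exact .inr (by rw [h, neg_neg])

/-- The product rule for the constraint along `n = α u + β e`, with the evolution and propagation
equations of `φ` and `(2/3) Θ - Σ` inserted. -/
lemma IsMatchingSurface.dirDeriv_constraintScalar (h : L.IsMatchingSurface ε Ξ X n)
    (hx : x ∈ L.domain) :
    DifferentiableAt ℝ (L.constraintScalar n) x ∧
      dirDeriv n (L.constraintScalar n) x = L.bbX n x := by
  have hn : DifferentiableAt ℝ n x :=
    (h.contDiffOn_normal.contDiffAt (L.isOpen_domain.mem_nhds hx)).differentiableAt one_ne_zero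
  have hα : DifferentiableAt ℝ (L.alpha n) x := (fderiv_ip hx hn (differentiableAt_u hx)).1.neg
  have hβ : DifferentiableAt ℝ (L.beta n) x := (fderiv_ip hx hn (differentiableAt_e hx)).1
  have hφ := differentiableAt_phi hx
  have hθ := differentiableAt_sheetTheta hx
  have hF : L.constraintScalar n = L.beta n * L.phi + L.alpha n * L.sheetTheta := by
    funext y
    simp only [constraintScalar, sheetTheta, Pi.add_apply, Pi.mul_apply]
    ring
  have hD := (hβ.hasFDerivAt.mul hφ.hasFDerivAt).add (hα.hasFDerivAt.mul hθ.hasFDerivAt)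
  rw [← hF] at hD
  refine ⟨hD.differentiableAt, ?_⟩
  obtain ⟨h1, h2, h3, h4⟩ := evolution_propagation hx
  simp only [dot, hat, dirDeriv_eq] at h1 h2 h3 h4
  have hnx : ∀ A : Coord →L[ℝ] ℝ, A (n x) = L.alpha n x * A (L.u x) + L.beta n x * A (L.e x) := by
    intro A
    conv_lhs => rw [h.no_sheet_component x hx]
    simp
  rw [dirDeriv_eq, hD.fderiv, hnx]
  simp only [add_apply, smul_apply, smul_eq_mul, h1, h2, h3, h4, bbX, dot, hat, dirDeriv_eq]
  simp only [sheetTheta]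
  ring

lemma IsMatchingSurface.hasDerivAt_constraintScalar (h : L.IsMatchingSurface ε Ξ X n)
    {γ : ℝ → Coord} {I : Set ℝ} (hγ : L.IsNormalCurve n γ I) {s : ℝ} (hs : s ∈ I) :
    HasDerivAt (fun s => L.constraintScalar n (γ s)) (L.bbX n (γ s)) s := by
  obtain ⟨hmem, hd⟩ := hγ s hs
  obtain ⟨hF, hX⟩ := h.dirDeriv_constraintScalar hmem
  rw [dirDeriv_eq] at hX
  rw [← hX]
  exact hF.hasFDerivAt.comp_hasDerivAt s hd

end LRSII

end LRS

/-- Functions on an open interval around `0` agree if and only if they agree at `0` and their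
derivatives agree. -/
lemma forall_eq_iff_of_hasDerivAt {f₁ f₂ f₁' f₂' : ℝ → ℝ} {a b : ℝ} (ha : a < 0) (hb : 0 < b)
    (h₁ : ∀ s ∈ Set.Ioo a b, HasDerivAt f₁ (f₁' s) s)
    (h₂ : ∀ s ∈ Set.Ioo a b, HasDerivAt f₂ (f₂' s) s) :
    (∀ s ∈ Set.Ioo a b, f₁ s = f₂ s) ↔ f₁ 0 = f₂ 0 ∧ ∀ s ∈ Set.Ioo a b, f₁' s = f₂' s := by
  have h0 : (0 : ℝ) ∈ Set.Ioo a b := ⟨ha, hb⟩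
  refine ⟨fun h => ⟨h 0 h0, fun s hs => ?_⟩, fun ⟨h, h'⟩ => ?_⟩
  · exact (h₁ s hs).unique ((h₂ s hs).congr_of_eventuallyEq
      (Filter.eventually_of_mem (isOpen_Ioo.mem_nhds hs) h))
  · refine isOpen_Ioo.eqOn_of_deriv_eq isPreconnected_Ioo
      (fun s hs => (h₁ s hs).differentiableAt.differentiableWithinAt)
      (fun s hs => (h₂ s hs).differentiableAt.differentiableWithinAt)
      (fun s hs => ?_) h0 h
    rw [(h₁ s hs).deriv, (h₂ s hs).deriv, h' s hs]

end
theorem mainTheorem3 (Λ ε : ℝ) (hε : ε = 1 ∨ ε = -1)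
    (L₁ L₂ : LRS.LRSII Λ) (Ξ : Set (Fin 3 → ℝ))
    (X₁ X₂ : (Fin 3 → ℝ) → LRS.Coord) (n₁ n₂ : LRS.Coord → LRS.Coord)
    (h₁ : L₁.IsMatchingSurface ε Ξ X₁ n₁) (h₂ : L₂.IsMatchingSurface ε Ξ X₂ n₂) :
    -- the relation between `α` and `β` on either side
    ((ε = 1 →
        (∀ x ∈ L₁.domain, L₁.beta n₁ x = √(1 + L₁.alpha n₁ x ^ 2) ∨
          L₁.beta n₁ x = -√(1 + L₁.alpha n₁ x ^ 2)) ∧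
        (∀ x ∈ L₂.domain, L₂.beta n₂ x = √(1 + L₂.alpha n₂ x ^ 2) ∨
          L₂.beta n₂ x = -√(1 + L₂.alpha n₂ x ^ 2))) ∧
      (ε = -1 →
        (∀ x ∈ L₁.domain, 1 ≤ L₁.alpha n₁ x ^ 2 ∧
          (L₁.beta n₁ x = √(L₁.alpha n₁ x ^ 2 - 1) ∨
            L₁.beta n₁ x = -√(L₁.alpha n₁ x ^ 2 - 1))) ∧
        (∀ x ∈ L₂.domain, 1 ≤ L₂.alpha n₂ x ^ 2 ∧
          (L₂.beta n₂ x = √(L₂.alpha n₂ x ^ 2 - 1) ∨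
            L₂.beta n₂ x = -√(L₂.alpha n₂ x ^ 2 - 1))))) ∧
    -- the derivative along the normal of either side of the constraint
    (∀ x ∈ L₁.domain, DifferentiableAt ℝ (L₁.constraintScalar n₁) x ∧
      LRS.dirDeriv n₁ (L₁.constraintScalar n₁) x = L₁.bbX n₁ x) ∧
    (∀ x ∈ L₂.domain, DifferentiableAt ℝ (L₂.constraintScalar n₂) x ∧
      LRS.dirDeriv n₂ (L₂.constraintScalar n₂) x = L₂.bbX n₂ x) ∧
    -- the normal derivatives agree on the matching surface if and only if `𝕏 = 𝕏̃` there
    (∀ ξ ∈ Ξ,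
      LRS.dirDeriv n₁ (L₁.constraintScalar n₁) (X₁ ξ) =
          LRS.dirDeriv n₂ (L₂.constraintScalar n₂) (X₂ ξ) ↔
        L₁.bbX n₁ (X₁ ξ) = L₂.bbX n₂ (X₂ ξ)) ∧
    -- the constraint is preserved along the normal curves if and only if `𝕏 = 𝕏̃` along them
    (∀ ξ ∈ Ξ, ∀ a b : ℝ, a < 0 → 0 < b → ∀ γ₁ γ₂ : ℝ → LRS.Coord,
      γ₁ 0 = X₁ ξ → γ₂ 0 = X₂ ξ →
      L₁.IsNormalCurve n₁ γ₁ (Set.Ioo a b) → L₂.IsNormalCurve n₂ γ₂ (Set.Ioo a b) →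
      ((∀ s ∈ Set.Ioo a b, L₁.constraintScalar n₁ (γ₁ s) = L₂.constraintScalar n₂ (γ₂ s)) ↔
        (L₁.constraintScalar n₁ (X₁ ξ) = L₂.constraintScalar n₂ (X₂ ξ) ∧
          ∀ s ∈ Set.Ioo a b, L₁.bbX n₁ (γ₁ s) = L₂.bbX n₂ (γ₂ s)))) := by
  refine ⟨⟨?_, ?_⟩, fun x hx => h₁.dirDeriv_constraintScalar hx,
    fun x hx => h₂.dirDeriv_constraintScalar hx, fun ξ hξ => ?_, ?_⟩
  · rintro rfl
    exact ⟨fun x hx => h₁.beta_eq hx, fun x hx => h₂.beta_eq hx⟩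
  · rintro rfl
    have key {L : LRS.LRSII Λ} {X : (Fin 3 → ℝ) → LRS.Coord} {n : LRS.Coord → LRS.Coord}
        (h : L.IsMatchingSurface (-1) Ξ X n) (x : LRS.Coord) (hx : x ∈ L.domain) :
        1 ≤ L.alpha n x ^ 2 ∧ (L.beta n x = √(L.alpha n x ^ 2 - 1) ∨
          L.beta n x = -√(L.alpha n x ^ 2 - 1)) := by
      refine ⟨?_, ?_⟩
      · linarith [h.beta_sq hx, sq_nonneg (L.beta n x)]
      · rw [sub_eq_neg_add]
        exact h.beta_eq hx
    exact ⟨key h₁, key h₂⟩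
  · rw [(h₁.dirDeriv_constraintScalar (h₁.mapsTo hξ)).2,
      (h₂.dirDeriv_constraintScalar (h₂.mapsTo hξ)).2]
  · intro ξ _ a b ha hb γ₁ γ₂ hγ₁ hγ₂ hc₁ hc₂
    rw [← hγ₁, ← hγ₂]
    exact forall_eq_iff_of_hasDerivAt ha hb (fun s hs => h₁.hasDerivAt_constraintScalar hc₁ hs)
      (fun s hs => h₂.hasDerivAt_constraintScalar hc₂ hs)
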